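/- **Theorem (weight $4$).** Let $\mathfrak{ham}_4^0$ be the Lie algebra of (formal) Hamiltonian vector fields on $\mathbb{R}^4$ vanishing at the origin, with polynomial potentials: it is identified with the real polynomials in $x_1,x_2,x_3,x_4$ without constant and linear terms, with the Poisson bracket $$\{f,g\}=\partial_1 f\,\partial_4 g+\partial_2 f\,\partial_3 g-\partial_3 f\,\partial_2 g-\partial_4 f\,\partial_1 g .$$ Its $m$-cochains are the alternating $\mathbb{R}$-multilinear forms $\sigma$ in $m$ arguments from $\mathfrak{ham}_4^0$, with the Chevalley–Eilenberg differential $d$ for trivial real coefficients (so $(d\sigma)(f,g)=-\sigma(\{f,g\})$ for $m=1$). A cochain $\sigma$ has weight $w$ if $\sigma(f_1,\dots,f_m)=0$ whenever each $f_i$ is homogeneous of degree $\ell_i$ and $\sum_i(\ell_i-2)\neq w$; equivalently, $\sigma$ lies in the span of the spaces $\mathfrak S_{\ell_1}\wedge\dots\wedge\mathfrak S_{\ell_m}$ with $\sum_i(\ell_i-2)=w$, where $\mathfrak S_\ell$ is the dual of the space of homogeneous polynomials of degree $\ell$. For $\xi\in\mathfrak{sp}(4,\mathbb{R})$ let $\hat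 J(\xi)(x)=\tfrac12\omega(\xi x,x)$, where $\omega(\partial_1,\partial_4)=\omega(\partial_2,\partial_3)=1$, $\omega$ is skew, and its other values on the pairs $(\partial_i,\partial_j)$, $i<j$, vanish. The relative cochain space $C^m$ of degree $m$ and weight $4$ consists of the $m$-cochains $\sigma$ of weight $4$ with $$i_{\hat J(\xi)}\sigma=0\quad\text{and}\quad i_{\hat J(\xi)}d\sigma=0\qquad\text{for all }\xi\in\mathfrak{sp}(4,\mathbb{R}),$$ and the relative Gel'fand–Kalinin–Fuks cohomology of weight $4$ is $H^m=\ker(d|_{C^m})/d(C^{m-1})$, where $C^{-1}=0$. Then: 1. The dimensions of $C^m$ and $H^m$ (the Betti numbers) are $$\begin{array}{c|ccccc} m&0&1&2&3&4\\\hline \dim C^m&0&0&0&1&3\\ \dim H^m&0&0&0&0&2\end{array}$$ and $C^m=0$, $H^m=0$ for all $m\ge 5$. In particular only $H^4$ is non-zero, and it is $2$-dimensional. 2. Let $z_{ijkl}$ denote the dual basis of the monomials $e_{ijkl}=\frac{x_1^i}{i!}\frac{x_2^j}{j!}\frac{x_3^k}{k!}\frac{x_4^l}{l!}$, and normalise the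 wedge product so that $z_\alpha\wedge z_\beta\wedge z_\gamma$ takes the value $1$ on $(e_\alpha,e_\beta,e_\gamma)$ for distinct $\alpha,\beta,\gamma$. Then $C^3=\mathbb{R}A$ for a cochain $A$ with $dA\ne0$ in which the following basis elements occur with exactly the coefficients shown: $$\begin{aligned} &-4\,z_{1002}\wedge z_{2100}\wedge z_{1012},\quad 2\,z_{0012}\wedge z_{1002}\wedge z_{3100},\quad 4\,z_{1002}\wedge z_{2010}\wedge z_{1102},\\ &-2\,z_{0012}\wedge z_{0210}\wedge z_{2110},\quad z_{0012}\wedge z_{0300}\wedge z_{2020},\quad -2\,z_{1002}\wedge z_{3000}\wedge z_{1003},\\ &-4\,z_{0012}\wedge z_{2010}\wedge z_{1201},\quad 4\,z_{0012}\wedge z_{2100}\wedge z_{1111},\quad -2\,z_{0003}\wedge z_{2010}\wedge z_{2101},\\ &2\,z_{0003}\wedge z_{2100}\wedge z_{2011},\quad z_{0003}\wedge z_{3000}\wedge z_{2002},\quad z_{0012}\wedge z_{0102}\wedge z_{4000},\\ &2\,z_{0012}\wedge z_{0111}\wedge z_{3100},\quad z_{0012}\wedge z_{0120}\wedge z_{2200}.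 \end{aligned}$$ -/

import Mathlib

noncomputable section

namespace GKF

/-! ### Cochains of a real Lie algebra with trivial real coefficients -/

section Cochains

variable (L : Type*) [LieRing L] [LieAlgebra ℝ L]

/-- The `m`-cochains: alternating `ℝ`-multilinear forms in `m` arguments. -/
abbrev Cochain (m : ℕ) : Type _ := L [⋀^Fin m]→ₗ[ℝ] ℝ

variable {L}

/-- Auxiliary multilinear form `v ↦ ∑ⱼ σ(v₁, …, [x, vⱼ], …, vₘ)`. -/
def derivMultilinear {m : ℕ} (x : L) (σ : Cochain L m) : MultilinearMap ℝ (fun _ : Fin m => L) ℝ :=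
  ∑ j, σ.toMultilinearMap.compLinearMap
    (Function.update (fun _ => LinearMap.id) j (LieAlgebra.ad ℝ L x : L →ₗ[ℝ] L))

theorem derivMultilinear_apply {m : ℕ} (x : L) (σ : Cochain L m) (v : Fin m → L) :
    derivMultilinear x σ v = ∑ j, σ (Function.update v j ⁅x, v j⁆) := by
  simp only [derivMultilinear, sum_apply, MultilinearMap.compLinearMap_apply]
  refine Finset.sum_congr rfl fun j _ => ?_
  change σ _ = σ _
  congr 1
  ext k
  by_cases h : k = j
  · subst h; simp
  · simp [h]

/-- The action of `x` on forms, up to sign: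
`(v₁, …, vₘ) ↦ ∑ⱼ σ(v₁, …, [x, vⱼ], …, vₘ)`. -/
def derivForm {m : ℕ} (x : L) (σ : Cochain L m) : Cochain L m where
  toMultilinearMap := derivMultilinear x σ
  map_eq_zero_of_eq' v i j hv hij := by
    change derivMultilinear x σ v = 0
    rw [derivMultilinear_apply, Finset.sum_eq_add_of_mem i j (Finset.mem_univ _)
      (Finset.mem_univ _) hij]
    · rw [add_comm, ← eq_neg_iff_add_eq_zero, ← σ.map_swap _ hij]
      congr 1
      ext k
      simp only [Function.comp_apply, Function.update_apply]
      by_cases hk : k = i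
      · subst hk; simp [hij, hv, hij.symm]
      · by_cases hk' : k = j
        · subst hk'; simp [hv]
        · simp [hk, hk', Equiv.swap_apply_of_ne_of_ne]
    · rintro k - ⟨hki, hkj⟩
      exact σ.map_eq_zero_of_eq _ (by simp [hki.symm, hkj.symm, hv]) hij

theorem derivForm_apply {m : ℕ} (x : L) (σ : Cochain L m) (v : Fin m → L) :
    derivForm x σ v = ∑ j, σ (Function.update v j ⁅x, v j⁆) :=
  derivMultilinear_apply x σ v

/-- `derivForm` as a linear map in `x`. -/
def derivFormLin {m : ℕ} (σ : Cochain L m) : L →ₗ[ℝ] Cochain L m where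
  toFun x := derivForm x σ
  map_add' x y := by
    ext v
    simp [derivForm_apply, Finset.sum_add_distrib]
  map_smul' c x := by
    ext v
    simp [derivForm_apply, Finset.mul_sum]

/-- The Chevalley–Eilenberg coboundary of `σ`, as a function:
`(dσ)(v₀, …, vₘ) = ∑_{i < j} (-1)^(i+1) σ(v₀, …, v̂ᵢ, …, [vᵢ, vⱼ], …, vₘ)`,
where `vᵢ` is omitted and `[vᵢ, vⱼ]` stands in the place of `vⱼ`. -/
def dFun {m : ℕ} (σ : Cochain L m) (v : Fin (m + 1) → L) : ℝ :=
  ∑ i : Fin (m + 1), ∑ j ∈ Finset.univ.filter (fun j => i < j),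
    (-1) ^ ((i : ℕ) + 1) * σ (i.removeNth (Function.update v j ⁅v i, v j⁆))

theorem dFun_swap {m : ℕ} (σ : Cochain L m) (v : Fin (m + 1) → L) {i j : Fin (m + 1)}
    (hij : i ≠ j) :
    (-1) ^ ((j : ℕ) + 1) * σ (j.removeNth (Function.update v i ⁅v j, v i⁆)) =
      (-1) ^ ((i : ℕ) + 1) * σ (i.removeNth (Function.update v j ⁅v i, v j⁆)) := by
  have h := σ.neg_one_pow_smul_map_removeNth_add_eq_zero_of_eq
    (v := Function.update (Function.update v i ⁅v i, v j⁆) j ⁅v i, v j⁆) (i := i) (j := j)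
    (by simp [hij]) hij
  rw [Fin.removeNth_update, Function.update_comm hij, Fin.removeNth_update] at h
  have h2 : σ (j.removeNth (Function.update v i ⁅v j, v i⁆)) =
      - σ (j.removeNth (Function.update v i ⁅v i, v j⁆)) := by
    obtain ⟨k, rfl⟩ := Fin.exists_succAbove_eq hij
    rw [Fin.removeNth_update_succAbove, Fin.removeNth_update_succAbove, ← lie_skew,
      AlternatingMap.map_update_neg]
  rw [h2]
  simp only [zsmul_eq_mul, Int.cast_pow, Int.cast_neg, Int.cast_one] at h
  rw [pow_succ, pow_succ]
  linarith

theorem dFun_eq {m : ℕ} (σ : Cochain L m) (v : Fin (m + 1) → L) :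
    dFun σ v = -(1 / 2 : ℝ) * AlternatingMap.alternatizeUncurryFin (derivFormLin σ) v := by
  set T : Fin (m + 1) → Fin (m + 1) → ℝ := fun i j =>
    (-1) ^ ((i : ℕ) + 1) * σ (i.removeNth (Function.update v j ⁅v i, v j⁆)) with hT
  have hS : ∀ i j, i ≠ j → T j i = T i j := fun i j hij => dFun_swap σ v hij
  have h1 : AlternatingMap.alternatizeUncurryFin (derivFormLin σ) v =
      - ∑ i, ∑ j ∈ Finset.univ.filter (fun j => j ≠ i), T i j := by
    rw [AlternatingMap.alternatizeUncurryFin_apply, ← Finset.sum_neg_distrib]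
    refine Finset.sum_congr rfl fun i _ => ?_
    have : ∑ j ∈ Finset.univ.filter (fun j => j ≠ i), T i j = ∑ k, T i (i.succAbove k) := by
      rw [Finset.sum_filter, Fin.sum_univ_succAbove _ i]
      simp [Fin.succAbove_ne]
    rw [this]
    simp only [derivFormLin, LinearMap.coe_mk, AddHom.coe_mk, derivForm_apply, hT,
      Fin.removeNth_update_succAbove, Fin.removeNth_apply, zsmul_eq_mul, Int.cast_pow,
      Int.cast_neg, Int.cast_one, Finset.mul_sum, pow_succ]
    simp
  have h2 : ∑ i, ∑ j ∈ Finset.univ.filter (fun j => j ≠ i), T i j =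
      ∑ i, ∑ j ∈ Finset.univ.filter (fun j => i < j), T i j +
        ∑ i, ∑ j ∈ Finset.univ.filter (fun j => i < j), T i j := by
    have h3 : ∑ i, ∑ j ∈ Finset.univ.filter (fun j => i < j), T i j =
        ∑ i, ∑ j ∈ Finset.univ.filter (fun j => j < i), T i j := by
      simp only [Finset.sum_filter]
      rw [Finset.sum_comm]
      refine Finset.sum_congr rfl fun i _ => Finset.sum_congr rfl fun j _ => ?_
      split_ifs with h
      · exact hS i j h.ne'
      · rfl
    refine Eq.trans ?_ (congrArg₂ (· + ·) rfl h3.symm)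
    simp only [Finset.sum_filter]
    rw [← Finset.sum_add_distrib]
    refine Finset.sum_congr rfl fun i _ => ?_
    rw [← Finset.sum_add_distrib]
    refine Finset.sum_congr rfl fun j _ => ?_
    rcases lt_trichotomy i j with h | h | h
    · simp [h, h.ne', h.not_gt]
    · simp [h]
    · simp [h, h.ne, h.not_gt]
  rw [h1, h2]
  simp only [dFun, hT]
  ring

/-- The Chevalley–Eilenberg coboundary operator (trivial coefficients). -/
def d {m : ℕ} : Cochain L m →ₗ[ℝ] Cochain L (m + 1) where
  toFun σ :=
    { toFun := dFun σ
      map_update_add' := fun v i x y => by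
        simp only [dFun_eq]
        rw [AlternatingMap.map_update_add, mul_add]
      map_update_smul' := fun v i c x => by
        simp only [dFun_eq]
        rw [AlternatingMap.map_update_smul, smul_eq_mul, smul_eq_mul]
        ring
      map_eq_zero_of_eq' := fun v i j hv hij => by
        rw [dFun_eq, AlternatingMap.map_eq_zero_of_eq _ v hv hij, mul_zero] }
  map_add' σ τ := by
    ext v
    change dFun _ v = dFun _ v + dFun _ v
    simp [dFun, mul_add, Finset.sum_add_distrib]
  map_smul' c σ := by
    ext v
    change dFun _ v = c * dFun _ v
    simp [dFun, Finset.mul_sum, mul_left_comm]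

theorem d_apply {m : ℕ} (σ : Cochain L m) (v : Fin (m + 1) → L) :
    d σ v = ∑ i : Fin (m + 1), ∑ j ∈ Finset.univ.filter (fun j => i < j),
      (-1) ^ ((i : ℕ) + 1) * σ (i.removeNth (Function.update v j ⁅v i, v j⁆)) :=
  rfl

/-- The interior product `i_x σ = σ(x, ·, …, ·)`; it is zero on `0`-cochains. -/
def interior (x : L) : (m : ℕ) → Cochain L m →ₗ[ℝ] Cochain L (m - 1)
  | 0 => 0
  | _ + 1 => AlternatingMap.curryLeftLinearMap.flip x

end Cochains

/-! ### Polynomial Hamiltonians on `ℝ⁴` -/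

/-- Polynomials in the coordinates `x₁, x₂, x₃, x₄` of `ℝ⁴`, here numbered `0, 1, 2, 3`. -/
abbrev Poly : Type := MvPolynomial (Fin 4) ℝ

open MvPolynomial in
/-- The Poisson bracket, with `{x₁, x₄} = {x₂, x₃} = 1`. -/
def poisson (f g : Poly) : Poly :=
  pderiv 0 f * pderiv 3 g + pderiv 1 f * pderiv 2 g
    - pderiv 2 f * pderiv 1 g - pderiv 3 f * pderiv 0 g

theorem pderiv_comm' (i j : Fin 4) (f : Poly) :
    MvPolynomial.pderiv i (MvPolynomial.pderiv j f) =
      MvPolynomial.pderiv j (MvPolynomial.pderiv i f) := by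
  have h : ⁅(MvPolynomial.pderiv i : Derivation ℝ Poly Poly),
      (MvPolynomial.pderiv j : Derivation ℝ Poly Poly)⁆ = 0 := by
    refine MvPolynomial.derivation_ext fun k => ?_
    rw [Derivation.commutator_apply]
    by_cases h1 : j = k <;> by_cases h2 : i = k <;>
      simp [MvPolynomial.pderiv_X, h1, h2]
  have := congrArg (fun D : Derivation ℝ Poly Poly => D f) h
  simpa [Derivation.commutator_apply, sub_eq_zero] using this

theorem pderiv_poisson (k : Fin 4) (f g : Poly) :
    MvPolynomial.pderiv k (poisson f g) =
      poisson (MvPolynomial.pderiv k f) g + poisson f (MvPolynomial.pderiv k g) := by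
  simp only [poisson, map_add, map_sub, Derivation.leibniz, smul_eq_mul, pderiv_comm' k]
  ring

/-- The Lie algebra of polynomial Hamiltonian vector fields on `ℝ⁴` that vanish at the origin,
through their Hamiltonian potentials normalised to have no constant term: polynomials `f` with
`f(0) = 0` and `(∂f/∂xᵢ)(0) = 0` for all `i`, that is, without constant and linear terms. -/
def Ham0 : Submodule ℝ Poly where
  carrier := {f | MvPolynomial.constantCoeff f = 0 ∧
    ∀ i, MvPolynomial.constantCoeff (MvPolynomial.pderiv i f) = 0}
  add_mem' {f g} hf hg := ⟨by simp [hf.1, hg.1], fun i => by simp [hf.2 i, hg.2 i]⟩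
  zero_mem' := ⟨by simp, fun i => by simp⟩
  smul_mem' c f hf := ⟨by
    simp [MvPolynomial.smul_eq_C_mul, hf.1], fun i => by
    rw [Derivation.map_smul]; simp [MvPolynomial.smul_eq_C_mul, hf.2 i]⟩

theorem poisson_mem {f g : Poly} (hf : f ∈ Ham0) (hg : g ∈ Ham0) : poisson f g ∈ Ham0 := by
  refine ⟨?_, fun k => ?_⟩
  · simp [poisson, hf.2, hg.2]
  · rw [pderiv_poisson]
    simp [poisson, hf.2, hg.2]

instance : Bracket Ham0 Ham0 := ⟨fun f g => ⟨poisson f g, poisson_mem f.2 g.2⟩⟩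

theorem coe_bracket (f g : Ham0) : ((⁅f, g⁆ : Ham0) : Poly) = poisson f g := rfl

instance : LieRing Ham0 where
  add_lie f g h := by
    ext1; simp only [coe_bracket, Submodule.coe_add, poisson, map_add]; ring
  lie_add f g h := by
    ext1; simp only [coe_bracket, Submodule.coe_add, poisson, map_add]; ring
  lie_self f := by
    ext1; simp only [coe_bracket, poisson, Submodule.coe_zero]; ring
  leibniz_lie f g h := by
    ext1
    simp only [coe_bracket, Submodule.coe_add]
    generalize (f : Poly) = f
    generalize (g : Poly) = g
    generalize (h : Poly) = h
    rw [poisson.eq_1 f (poisson g h), poisson.eq_1 g (poisson f h),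
      poisson.eq_1 (poisson f g) h]
    simp only [pderiv_poisson]
    simp only [poisson]
    simp only [pderiv_comm' 1 0, pderiv_comm' 2 0, pderiv_comm' 3 0, pderiv_comm' 2 1,
      pderiv_comm' 3 1, pderiv_comm' 3 2]
    ring

instance : LieAlgebra ℝ Ham0 where
  lie_smul c f g := by
    ext1
    simp only [coe_bracket, Submodule.coe_smul, poisson, Derivation.map_smul, mul_smul_comm, smul_sub, smul_add]

/-! ### The momentum map of `sp(4, ℝ)` -/

/-- The matrix of the symplectic form: `ω(∂₁, ∂₄) = ω(∂₂, ∂₃) = 1`. -/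
def Omega : Matrix (Fin 4) (Fin 4) ℝ :=
  !![0, 0, 0, 1; 0, 0, 1, 0; 0, -1, 0, 0; -1, 0, 0, 0]

/-- The space `sp(4, ℝ)` of matrices `ξ` with `ω(ξ u, v) + ω(u, ξ v) = 0`. -/
abbrev sp4 : Submodule ℝ (Matrix (Fin 4) (Fin 4) ℝ) :=
  skewAdjointMatricesSubmodule Omega

open MvPolynomial in
/-- The quadratic form `x ↦ ω(ξ x, x) / 2`, as a polynomial. -/
def momentumPoly (ξ : Matrix (Fin 4) (Fin 4) ℝ) : Poly :=
  C (1 / 2) * ∑ i, ∑ j, C ((ξ.transpose * Omega) i j) * X i * X j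

theorem momentumPoly_mem (ξ : Matrix (Fin 4) (Fin 4) ℝ) : momentumPoly ξ ∈ Ham0 := by
  refine ⟨by simp [momentumPoly], fun k => ?_⟩
  simp [momentumPoly, Derivation.leibniz]

/-- The momentum map of the linear action of `Sp(4, ℝ)` on `ℝ⁴`. -/
def momentum (ξ : sp4) : Ham0 := ⟨momentumPoly ξ, momentumPoly_mem ξ⟩

/-! ### Weights, relative cochains and cohomology -/

/-- The `m`-cochains of weight `w`: the homogeneous polynomials of degree `ℓ` have dual weight
`ℓ - 2`, so `σ` has weight `w` if it vanishes on all homogeneous polynomials `f₁, …, fₘ` of degrees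
`ℓ₁, …, ℓₘ` with `∑ (ℓᵢ - 2) ≠ w`. -/
def weightCochain (m : ℕ) (w : ℤ) : Submodule ℝ (Cochain Ham0 m) where
  carrier := {σ | ∀ (ℓ : Fin m → ℕ) (f : Fin m → Ham0),
    (∀ i, (f i : Poly).IsHomogeneous (ℓ i)) → ∑ i, ((ℓ i : ℤ) - 2) ≠ w → σ f = 0}
  add_mem' {σ τ} hσ hτ ℓ f hf hw := by simp [hσ ℓ f hf hw, hτ ℓ f hf hw]
  zero_mem' ℓ f hf hw := by simp
  smul_mem' c σ hσ ℓ f hf hw := by simp [hσ ℓ f hf hw]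

/-- The `m`-cochains of weight `w` relative to `sp(4, ℝ)`: those with `i_{J(ξ)} σ = 0` and
`i_{J(ξ)} dσ = 0` for all `ξ ∈ sp(4, ℝ)`. -/
def relCochain (m : ℕ) (w : ℤ) : Submodule ℝ (Cochain Ham0 m) where
  carrier := {σ | σ ∈ weightCochain m w ∧ ∀ ξ : sp4,
    interior (momentum ξ) m σ = 0 ∧ interior (momentum ξ) (m + 1) (d σ) = 0}
  add_mem' {σ τ} hσ hτ := ⟨add_mem hσ.1 hτ.1, fun ξ => by
    rw [map_add, map_add, map_add, (hσ.2 ξ).1, (hσ.2 ξ).2, (hτ.2 ξ).1, (hτ.2 ξ).2]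
    exact ⟨add_zero _, add_zero _⟩⟩
  zero_mem' := ⟨zero_mem _, fun ξ => by simp⟩
  smul_mem' c σ hσ := ⟨Submodule.smul_mem _ c hσ.1, fun ξ => by
    rw [map_smul, map_smul, map_smul, (hσ.2 ξ).1, (hσ.2 ξ).2]
    exact ⟨smul_zero _, smul_zero _⟩⟩

/-- Relative cocycles. -/
def relCocycle (m : ℕ) (w : ℤ) : Submodule ℝ (Cochain Ham0 m) :=
  relCochain m w ⊓ LinearMap.ker d

/-- Relative coboundaries: the image of the relative cochains of one degree less. -/
def relCoboundary : (m : ℕ) → (w : ℤ) → Submodule ℝ (Cochain Ham0 m)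
  | 0, _ => ⊥
  | m + 1, w => (relCochain m w).map d

/-- The quotient space `Z / (B ∩ Z)`. -/
abbrev Subquotient {V : Type*} [AddCommGroup V] [Module ℝ V] (Z B : Submodule ℝ V) : Type _ :=
  Z ⧸ B.submoduleOf Z

/-- The relative cohomology group of degree `m` and weight `w`: cocycles modulo coboundaries. -/
abbrev RelCohomology (m : ℕ) (w : ℤ) : Type :=
  Subquotient (relCocycle m w) (relCoboundary m w)

/-! ### The standard basis -/

/-- The polynomial `x₁^a x₂^b x₃^c x₄^e / (a! b! c! e!)`. -/
def basisPoly (a b c e : ℕ) : Poly :=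
  MvPolynomial.monomial (Finsupp.equivFunOnFinite.symm ![a, b, c, e])
    (1 / (a.factorial * b.factorial * c.factorial * e.factorial : ℝ))

theorem basisPoly_mem {a b c e : ℕ} (h : 2 ≤ a + b + c + e) : basisPoly a b c e ∈ Ham0 := by
  classical
  refine ⟨?_, fun i => ?_⟩
  · rw [basisPoly, MvPolynomial.constantCoeff_monomial, if_neg]
    intro h0
    have h1 := fun k => DFunLike.congr_fun h0 k
    have := h1 0; have := h1 1; have := h1 2; have := h1 3
    simp at *
    omega
  · rw [basisPoly, MvPolynomial.pderiv_monomial, MvPolynomial.constantCoeff_monomial, if_neg]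
    intro h0
    have h1 := fun k => DFunLike.congr_fun h0 k
    have h2 := h1 0; have h3 := h1 1; have h4 := h1 2; have h5 := h1 3
    clear h1 h0
    fin_cases i <;> simp at h2 h3 h4 h5 <;> omega

/-- The element `x₁^a x₂^b x₃^c x₄^e / (a! b! c! e!)` of `Ham0`, where `a + b + c + e ≥ 2`. -/
def basisElt (a b c e : ℕ) (h : 2 ≤ a + b + c + e := by norm_num) : Ham0 :=
  ⟨basisPoly a b c e, basisPoly_mem h⟩

end GKF

end

/-!
Contraction with `sp(4)` kills every argument of degree `2`, so a relative cochain of weight `4` is an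
`sp(4)`-invariant alternating form in arguments of degree at least `3`, each of which contributes at
least `1` to the weight. Hence `C^m = 0` for `m ≥ 5`, and it remains to find the invariants in
`S₆`, `S₃ ∧ S₅`, `Λ² S₄`, `Λ² S₃ ⊗ S₄` and `Λ⁴ S₃`.

*Upper bounds.* For an invariant form `σ`, the arguments `x` with `σ(x, ·, …) = 0` form a subspace
stable under `sp(4)`, and a homogeneous component is generated by the power of `x₁` under lowering
operators. So `σ` vanishes if it vanishes with first argument `x₁^k`. The remaining form is
invariant under the operators that annihilate `x₁`, and under these a homogeneous component is
generated by the power of `x₄`. With the first two arguments fixed, the operators `x₂ ∂₃` and `x₃ ∂₂`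
remain, and remove `x₂` from the third and `x₃` from the fourth argument. The diagonal torus allows few
coefficients among those that are left: none in degree one, a single one in degree two, which vanishes
by alternation, one in degree three (`relCochain_three_eq_zero`), and ten in degree four, which
alternation and invariance reduce to three (`relCochain_four_eq_zero`).

*Existence.* A multigraph on `m` vertices defines an invariant form in `m` arguments: the Poisson
bivector is applied along every edge to the product of the arguments, and the result is evaluated at
the origin. Invariance holds since linear Hamiltonian vector fields preserve the bivector and vanish at
the origin; the degree of each argument is the valence of its vertex. Antisymmetrising gives relative
cochains (`graphCochain_mem`): one from the graph with valences `3, 3, 4`, and three independent ones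
from the unions of three perfect matchings of four vertices. On monomials these cochains count signed
ways to pair derivatives, which is a finite computation (`graphCochain_mono`).

*Cohomology.* The generator of `C^3` has non-zero coboundary, by evaluation on four monomials, so
`H^3 = 0`. The coboundary preserves relative cochains, so it maps `C^4` to `C^5 = 0`, and `H^4` is `C^4`
modulo a line.
-/

namespace GKF

/-! ### Invariance and contraction of cochains -/

section Cochains

variable {L : Type*} [LieRing L] [LieAlgebra ℝ L] {m : ℕ}

theorem derivForm_zero (x : L) (σ : Cochain L 0) : derivForm x σ = 0 := by
  ext v
  simp [derivForm_apply]

theorem ext_curryLeft {σ τ : Cochain L (m + 1)} (h : ∀ x, σ.curryLeft x = τ.curryLeft x) :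
    σ = τ := by
  ext v
  have := congrArg (fun ρ => ρ (Fin.tail v)) (h (v 0))
  simpa [AlternatingMap.curryLeft_apply_apply, Matrix.vecCons] using this

theorem curryLeft_sub (σ τ : Cochain L (m + 1)) (x : L) :
    (σ - τ).curryLeft x = σ.curryLeft x - τ.curryLeft x := rfl

theorem derivForm_add (x : L) (σ τ : Cochain L m) :
    derivForm x (σ + τ) = derivForm x σ + derivForm x τ := by
  ext v; simp [derivForm_apply, Finset.sum_add_distrib]

theorem derivForm_neg (x : L) (σ : Cochain L m) :
    derivForm x (-σ) = -derivForm x σ := by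
  ext v; simp [derivForm_apply]

theorem derivForm_sub (x : L) (σ τ : Cochain L m) :
    derivForm x (σ - τ) = derivForm x σ - derivForm x τ := by
  ext v; simp [derivForm_apply]

/-- The Leibniz rule for the contraction of a form with an argument. -/
theorem curryLeft_derivForm (q x : L) (σ : Cochain L (m + 1)) :
    (derivForm q σ).curryLeft x = σ.curryLeft ⁅q, x⁆ + derivForm q (σ.curryLeft x) := by
  ext v
  simp only [AlternatingMap.curryLeft_apply_apply, derivForm_apply, AlternatingMap.add_apply,
    Fin.sum_univ_succ]
  congr 1
  · congr 1
    ext k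
    refine Fin.cases ?_ (fun k => ?_) k <;> simp [Matrix.vecCons]
  · refine Finset.sum_congr rfl fun j _ => ?_
    congr 1
    ext k
    refine Fin.cases ?_ (fun k => ?_) k
    · simp [Matrix.vecCons, Function.update_of_ne, (Fin.succ_ne_zero j).symm]
    · by_cases h : k = j
      · subst h; simp [Matrix.vecCons]
      · simp [Matrix.vecCons, h]

theorem curryLeft_swap (σ : Cochain L (m + 2)) (x y : L) :
    (σ.curryLeft x).curryLeft y = -(σ.curryLeft y).curryLeft x := by
  have h := AlternatingMap.curryLeft_same σ (x + y)
  simp only [map_add, AlternatingMap.curryLeft_add,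
    LinearMap.add_apply, AlternatingMap.curryLeft_same, zero_add, add_zero] at h
  exact eq_neg_of_add_eq_zero_right h

/-- A form annihilated by the contraction with `v i` vanishes on `v`, whatever the position `i`. -/
theorem apply_eq_zero_of_curryLeft (σ : Cochain L (m + 1)) (v : Fin (m + 1) → L)
    (i : Fin (m + 1)) (h : σ.curryLeft (v i) = 0) : σ v = 0 := by
  have h1 : σ (v ∘ Equiv.swap 0 i) = 0 := by
    have := congrArg (fun τ => τ (Fin.tail (v ∘ Equiv.swap 0 i))) h
    simp only [AlternatingMap.curryLeft_apply_apply, AlternatingMap.zero_apply] at this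
    rw [← this]
    congr 1
    ext k
    refine Fin.cases ?_ (fun k => ?_) k <;> simp [Matrix.vecCons, Fin.tail]
  rw [AlternatingMap.map_perm] at h1
  rcases Int.units_eq_one_or (Equiv.Perm.sign (Equiv.swap 0 i)) with h2 | h2 <;>
    simpa [h2] using h1

/-- `derivForm` is minus the Lie derivative, so it reverses the sign of the bracket. -/
theorem derivForm_derivForm (x y : L) (σ : Cochain L m) :
    derivForm x (derivForm y σ) = derivForm y (derivForm x σ) - derivForm ⁅x, y⁆ σ := by
  induction m with
  | zero => simp [derivForm_zero]
  | succ m ih =>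
    refine ext_curryLeft fun z => ?_
    have h : σ.curryLeft ⁅⁅x, y⁆, z⁆ = σ.curryLeft ⁅x, ⁅y, z⁆⁆ - σ.curryLeft ⁅y, ⁅x, z⁆⁆ := by
      rw [← map_sub, lie_lie]
    simp only [curryLeft_derivForm, curryLeft_sub, derivForm_add, ih, h]
    abel

/-- Cartan's formula. The sign comes from `derivForm` being minus the Lie derivative. -/
theorem curryLeft_d (x : L) (σ : Cochain L (m + 1)) :
    (d σ).curryLeft x = -derivForm x σ - d (σ.curryLeft x) := by
  ext v
  rw [AlternatingMap.curryLeft_apply_apply, d_apply, Fin.sum_univ_succ, AlternatingMap.sub_apply,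
    AlternatingMap.neg_apply, derivForm_apply, d_apply, Finset.sum_filter, Fin.sum_univ_succ,
    sub_eq_add_neg]
  congr 1
  · simp only [Fin.val_zero, lt_self_iff_false, if_false, zero_add, pow_one, Fin.succ_pos, if_true,
      Matrix.cons_val_succ, Matrix.cons_val_zero, neg_mul, one_mul, Finset.sum_neg_distrib]
    congr 1
    refine Finset.sum_congr rfl fun j _ => ?_
    congr 1
    ext k
    by_cases h : k = j
    · subst h; simp [Fin.removeNth]
    · simp [Fin.removeNth, h]
  · rw [← Finset.sum_neg_distrib]
    refine Finset.sum_congr rfl fun i _ => ?_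
    rw [Finset.sum_filter, Finset.sum_filter, Fin.sum_univ_succ, if_neg (by simp), zero_add,
      ← Finset.sum_neg_distrib]
    refine Finset.sum_congr rfl fun j _ => ?_
    simp only [Fin.succ_lt_succ_iff, Fin.val_succ, Matrix.cons_val_succ]
    split_ifs
    · rw [pow_succ _ ((i : ℕ) + 1), mul_neg_one, neg_mul, AlternatingMap.curryLeft_apply_apply]
      congr 3
      ext k
      refine Fin.cases ?_ (fun k => ?_) k
      · simp [Fin.removeNth, Matrix.vecCons, Function.update_of_ne, (Fin.succ_ne_zero j).symm]
      · simp only [Fin.removeNth, Matrix.cons_val_succ, Fin.succ_succAbove_succ]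
        by_cases h : i.succAbove k = j
        · rw [h]; simp
        · rw [Function.update_of_ne h, Function.update_of_ne (by simpa using h)]; simp
    · simp

/-- The Lie derivative commutes with the coboundary. -/
theorem derivForm_d (x : L) (σ : Cochain L m) : derivForm x (d σ) = d (derivForm x σ) := by
  induction m with
  | zero =>
    have h : ∀ τ : Cochain L 0, d τ = 0 := fun τ => by
      ext v
      simp [d_apply, Finset.sum_filter]
    rw [h, h]
    ext v
    simp [derivForm_apply]
  | succ m ih =>
    refine ext_curryLeft fun y => ?_
    simp only [curryLeft_derivForm, curryLeft_d, derivForm_neg,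
      derivForm_sub, ih, map_add]
    rw [derivForm_derivForm x y]
    abel

end Cochains

open MvPolynomial

/-! ### The monomial basis and the brackets of its elements -/

theorem basisPoly_mul (a b c e a' b' c' e' : ℕ) :
    basisPoly a b c e * basisPoly a' b' c' e' =
      ((a + a').choose a * (b + b').choose b * (c + c').choose c * (e + e').choose e : ℝ) •
        basisPoly (a + a') (b + b') (c + c') (e + e') := by
  rw [basisPoly, basisPoly, basisPoly, monomial_mul, smul_monomial]
  refine congrArg₂ (fun s r => monomial s r) ?_ ?_
  · ext i
    fin_cases i <;> simp
  · have h : ∀ n k : ℕ, (((n + k).choose n : ℕ) : ℝ) =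
        (n + k).factorial / (n.factorial * k.factorial) := fun n k => by
      rw [eq_div_iff (by positivity), ← mul_assoc]
      have := Nat.choose_mul_factorial_mul_factorial (Nat.le_add_right n k)
      rw [Nat.add_sub_cancel_left] at this
      exact_mod_cast this
    simp only [h, smul_eq_mul]
    field_simp

theorem pderiv_basisPoly_zero (a b c e : ℕ) :
    pderiv 0 (basisPoly a b c e) = if a = 0 then 0 else basisPoly (a - 1) b c e := by
  rcases a with _ | a
  · simp [basisPoly, pderiv_monomial]
  · simp only [basisPoly, pderiv_monomial, Nat.factorial_succ, Nat.add_sub_cancel,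
      Nat.add_eq_zero_iff, one_ne_zero, and_false, if_false]
    refine congrArg₂ (fun s r => monomial s r) ?_ ?_
    · ext i
      fin_cases i <;> simp
    · simp only [Finsupp.equivFunOnFinite_symm_apply_apply]
      simp
      field_simp

theorem pderiv_basisPoly_one (a b c e : ℕ) :
    pderiv 1 (basisPoly a b c e) = if b = 0 then 0 else basisPoly a (b - 1) c e := by
  rcases b with _ | b
  · simp [basisPoly, pderiv_monomial]
  · simp only [basisPoly, pderiv_monomial, Nat.factorial_succ, Nat.add_sub_cancel,
      Nat.add_eq_zero_iff, one_ne_zero, and_false, if_false]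
    refine congrArg₂ (fun s r => monomial s r) ?_ ?_
    · ext i
      fin_cases i <;> simp
    · simp only [Finsupp.equivFunOnFinite_symm_apply_apply]
      simp
      field_simp

theorem pderiv_basisPoly_two (a b c e : ℕ) :
    pderiv 2 (basisPoly a b c e) = if c = 0 then 0 else basisPoly a b (c - 1) e := by
  rcases c with _ | c
  · simp [basisPoly, pderiv_monomial]
  · simp only [basisPoly, pderiv_monomial, Nat.factorial_succ, Nat.add_sub_cancel,
      Nat.add_eq_zero_iff, one_ne_zero, and_false, if_false]
    refine congrArg₂ (fun s r => monomial s r) ?_ ?_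
    · ext i
      fin_cases i <;> simp
    · simp only [Finsupp.equivFunOnFinite_symm_apply_apply]
      simp
      field_simp

theorem pderiv_basisPoly_three (a b c e : ℕ) :
    pderiv 3 (basisPoly a b c e) = if e = 0 then 0 else basisPoly a b c (e - 1) := by
  rcases e with _ | e
  · simp [basisPoly, pderiv_monomial]
  · simp only [basisPoly, pderiv_monomial, Nat.factorial_succ, Nat.add_sub_cancel,
      Nat.add_eq_zero_iff, one_ne_zero, and_false, if_false]
    refine congrArg₂ (fun s r => monomial s r) ?_ ?_
    · ext i
      fin_cases i <;> simp
    · simp only [Finsupp.equivFunOnFinite_symm_apply_apply]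
      simp
      field_simp

/-- The basis element `x₁^a x₂^b x₃^c x₄^e / (a! b! c! e!)` of `Ham0`, with the value `0` where
this monomial has degree less than `2`. -/
noncomputable def mono (a b c e : ℕ) : Ham0 :=
  if h : 2 ≤ a + b + c + e then basisElt a b c e h else 0

theorem basisElt_eq_mono (a b c e : ℕ) (h : 2 ≤ a + b + c + e) :
    basisElt a b c e h = mono a b c e := by
  rw [mono, dif_pos h]

theorem coe_mono {a b c e : ℕ} (h : 2 ≤ a + b + c + e) :
    (mono a b c e : Poly) = basisPoly a b c e := by
  rw [mono, dif_pos h]; rfl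

theorem isHomogeneous_mono (a b c e : ℕ) :
    (mono a b c e : Poly).IsHomogeneous (a + b + c + e) := by
  rw [mono]
  split_ifs with h
  · refine isHomogeneous_monomial _ ?_
    simp [Finsupp.degree_eq_sum, Fin.sum_univ_four]
  · exact isHomogeneous_zero _ _ _

theorem mono_of_lt {a b c e : ℕ} (h : a + b + c + e < 2) : mono a b c e = 0 := by
  rw [mono, dif_neg (by omega)]

/-! ### The action of the quadratic Hamiltonians on monomials -/

/-- The bracket with `x₁² / 2` is the operator `x₁ ∂₄`. The names of this lemma and of the next ones list
the exponents of the quadratic monomial. -/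
theorem lie_2000 (a b c e : ℕ) :
    ⁅mono 2 0 0 0, mono a b c e⁆ =
      (if e = 0 then 0 else ((a + 1 : ℕ) : ℝ) • mono (a + 1) b c (e - 1)) := by
  rcases lt_or_ge (a + b + c + e) 2 with h | h
  · rcases e with _ | e <;> simp (disch := omega) [mono_of_lt]
  · rcases e with _ | e <;> ext1 <;>
      simp (disch := omega) [coe_bracket, coe_mono, poisson, pderiv_basisPoly_zero,
        pderiv_basisPoly_one, pderiv_basisPoly_two, pderiv_basisPoly_three, basisPoly_mul,
        add_comm]

theorem lie_1100 (a b c e : ℕ) :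
    ⁅mono 1 1 0 0, mono a b c e⁆ =
      (if e = 0 then 0 else ((b + 1 : ℕ) : ℝ) • mono a (b + 1) c (e - 1)) +
        (if c = 0 then 0 else ((a + 1 : ℕ) : ℝ) • mono (a + 1) b (c - 1) e) := by
  rcases lt_or_ge (a + b + c + e) 2 with h | h
  · rcases e with _ | e <;> rcases c with _ | c <;> simp (disch := omega) [mono_of_lt]
  · rcases e with _ | e <;> rcases c with _ | c <;> ext1 <;>
      simp (disch := omega) [coe_bracket, coe_mono, poisson, pderiv_basisPoly_zero,
        pderiv_basisPoly_one, pderiv_basisPoly_two, pderiv_basisPoly_three, basisPoly_mul,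
        add_comm]

theorem lie_1010 (a b c e : ℕ) :
    ⁅mono 1 0 1 0, mono a b c e⁆ =
      (if e = 0 then 0 else ((c + 1 : ℕ) : ℝ) • mono a b (c + 1) (e - 1)) -
        (if b = 0 then 0 else ((a + 1 : ℕ) : ℝ) • mono (a + 1) (b - 1) c e) := by
  rcases lt_or_ge (a + b + c + e) 2 with h | h
  · rcases e with _ | e <;> rcases b with _ | b <;> simp (disch := omega) [mono_of_lt]
  · rcases e with _ | e <;> rcases b with _ | b <;> ext1 <;>
      simp (disch := omega) [coe_bracket, coe_mono, poisson, pderiv_basisPoly_zero,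
        pderiv_basisPoly_one, pderiv_basisPoly_two, pderiv_basisPoly_three, basisPoly_mul,
        add_comm]

theorem lie_0200 (a b c e : ℕ) :
    ⁅mono 0 2 0 0, mono a b c e⁆ =
      (if c = 0 then 0 else ((b + 1 : ℕ) : ℝ) • mono a (b + 1) (c - 1) e) := by
  rcases lt_or_ge (a + b + c + e) 2 with h | h
  · rcases c with _ | c <;> simp (disch := omega) [mono_of_lt]
  · rcases c with _ | c <;> ext1 <;>
      simp (disch := omega) [coe_bracket, coe_mono, poisson, pderiv_basisPoly_zero,
        pderiv_basisPoly_one, pderiv_basisPoly_two, pderiv_basisPoly_three, basisPoly_mul,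
        add_comm]

theorem lie_0020 (a b c e : ℕ) :
    ⁅mono 0 0 2 0, mono a b c e⁆ =
      -(if b = 0 then 0 else ((c + 1 : ℕ) : ℝ) • mono a (b - 1) (c + 1) e) := by
  rcases lt_or_ge (a + b + c + e) 2 with h | h
  · rcases b with _ | b <;> simp (disch := omega) [mono_of_lt]
  · rcases b with _ | b <;> ext1 <;>
      simp (disch := omega) [coe_bracket, coe_mono, poisson, pderiv_basisPoly_zero,
        pderiv_basisPoly_one, pderiv_basisPoly_two, pderiv_basisPoly_three, basisPoly_mul,
        add_comm]

theorem lie_0011 (a b c e : ℕ) :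
    ⁅mono 0 0 1 1, mono a b c e⁆ =
      -(if b = 0 then 0 else ((e + 1 : ℕ) : ℝ) • mono a (b - 1) c (e + 1)) -
        (if a = 0 then 0 else ((c + 1 : ℕ) : ℝ) • mono (a - 1) b (c + 1) e) := by
  rcases lt_or_ge (a + b + c + e) 2 with h | h
  · rcases b with _ | b <;> rcases a with _ | a <;> simp (disch := omega) [mono_of_lt]
  · rcases b with _ | b <;> rcases a with _ | a <;> ext1 <;>
      simp (disch := omega) [coe_bracket, coe_mono, poisson, pderiv_basisPoly_zero,
        pderiv_basisPoly_one, pderiv_basisPoly_two, pderiv_basisPoly_three, basisPoly_mul,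
        add_comm]

theorem lie_0002 (a b c e : ℕ) :
    ⁅mono 0 0 0 2, mono a b c e⁆ =
      -(if a = 0 then 0 else ((e + 1 : ℕ) : ℝ) • mono (a - 1) b c (e + 1)) := by
  rcases lt_or_ge (a + b + c + e) 2 with h | h
  · rcases a with _ | a <;> simp (disch := omega) [mono_of_lt]
  · rcases a with _ | a <;> ext1 <;>
      simp (disch := omega) [coe_bracket, coe_mono, poisson, pderiv_basisPoly_zero,
        pderiv_basisPoly_one, pderiv_basisPoly_two, pderiv_basisPoly_three, basisPoly_mul,
        add_comm]

/-- The monomials are the weight vectors of the torus spanned by `x₁ x₄` and `x₂ x₃`. -/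
theorem lie_1001 (a b c e : ℕ) :
    ⁅mono 1 0 0 1, mono a b c e⁆ = ((e : ℝ) - a) • mono a b c e := by
  rcases lt_or_ge (a + b + c + e) 2 with h | h
  · simp (disch := omega) [mono_of_lt]
  · rcases a with _ | a <;> rcases e with _ | e <;> ext1 <;>
      simp (disch := omega) [coe_bracket, coe_mono, poisson, pderiv_basisPoly_zero,
        pderiv_basisPoly_one, pderiv_basisPoly_two, pderiv_basisPoly_three, basisPoly_mul,
        add_comm, sub_smul] <;> module

theorem lie_0110 (a b c e : ℕ) :
    ⁅mono 0 1 1 0, mono a b c e⁆ = ((c : ℝ) - b) • mono a b c e := by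
  rcases lt_or_ge (a + b + c + e) 2 with h | h
  · simp (disch := omega) [mono_of_lt]
  · rcases b with _ | b <;> rcases c with _ | c <;> ext1 <;>
      simp (disch := omega) [coe_bracket, coe_mono, poisson, pderiv_basisPoly_zero,
        pderiv_basisPoly_one, pderiv_basisPoly_two, pderiv_basisPoly_three, basisPoly_mul,
        add_comm, sub_smul] <;> module

/-! ### Quadratic Hamiltonians and the momentum map -/

theorem eq_C_of_isHomogeneous_zero {f : Poly} (hf : f.IsHomogeneous 0) :
    f = C (constantCoeff f) := by
  rw [constantCoeff_eq, ← homogeneousComponent_zero, homogeneousComponent_of_mem hf, if_pos rfl]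

/-- A quadratic form is given by its Hessian, by Euler's identity applied twice. -/
theorem quad_eq (f : Poly) (hf : f.IsHomogeneous 2) :
    f = C (1 / 2) * ∑ i, ∑ j, C (constantCoeff (pderiv j (pderiv i f))) * X i * X j := by
  have h1 : ∀ i j, C (constantCoeff (pderiv j (pderiv i f))) = pderiv j (pderiv i f) :=
    fun i j => (eq_C_of_isHomogeneous_zero (hf.pderiv (i := i)).pderiv).symm
  have h2 : ∀ i, ∑ j, X j * pderiv j (pderiv i f) = pderiv i f := fun i => by
    simpa using (hf.pderiv (i := i)).sum_X_mul_pderiv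
  have h3 := hf.sum_X_mul_pderiv
  have h4 : ∑ i, ∑ j, C (constantCoeff (pderiv j (pderiv i f))) * X i * X j = 2 • f := by
    rw [← h3]
    refine Finset.sum_congr rfl fun i _ => ?_
    conv_rhs => rw [← h2 i, Finset.mul_sum]
    refine Finset.sum_congr rfl fun j _ => ?_
    rw [h1]; ring
  rw [h4, nsmul_eq_mul, ← mul_assoc, ← map_natCast (C (R := ℝ)), ← map_mul]
  norm_num

/-- The momentum map is onto the quadratic Hamiltonians. -/
theorem exists_momentum_eq (f : Ham0) (hf : (f : Poly).IsHomogeneous 2) :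
    ∃ ξ : sp4, momentum ξ = f := by
  set M : Matrix (Fin 4) (Fin 4) ℝ :=
    fun i j => constantCoeff (pderiv j (pderiv i (f : Poly))) with hM
  have hs : M.transpose = M := by
    ext i j; rw [Matrix.transpose_apply]; simp only [hM, pderiv_comm' i j]
  have hO : Omega.transpose = -Omega := by
    ext i j; fin_cases i <;> fin_cases j <;> simp [Omega]
  have hO2 : Omega * Omega = -1 := by
    ext i j; fin_cases i <;> fin_cases j <;> simp [Omega, Matrix.mul_apply, Fin.sum_univ_four]
  have h1 : (Omega * M).transpose * Omega = M := by
    rw [Matrix.transpose_mul, hs, hO, Matrix.mul_assoc, Matrix.neg_mul, hO2]; simp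
  -- As `Ω² = -1` and `Ωᵀ = -Ω`, the matrix `Ω M` satisfies `(Ω M)ᵀ Ω = M`.
  refine ⟨⟨Omega * M, ?_⟩, ?_⟩
  · rw [mem_skewAdjointMatricesSubmodule]
    change (Omega * M).transpose * Omega = Omega * (-(Omega * M))
    rw [h1, Matrix.mul_neg, ← Matrix.mul_assoc, hO2]; simp
  · ext1
    change momentumPoly (Omega * M) = f
    rw [momentumPoly, h1]
    exact (quad_eq f hf).symm

theorem isHomogeneous_momentum (ξ : sp4) : (momentum ξ : Poly).IsHomogeneous 2 := by
  change (momentumPoly ξ).IsHomogeneous 2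
  rw [momentumPoly]
  refine (IsHomogeneous.sum _ _ _ fun i _ => IsHomogeneous.sum _ _ _ fun j _ => ?_).C_mul _
  rw [mul_assoc]
  exact ((isHomogeneous_X ℝ i).mul (isHomogeneous_X ℝ j)).C_mul _

/-! ### The monomials span -/

theorem span_mono (S : Submodule ℝ Ham0)
    (h : ∀ a b c e, 2 ≤ a + b + c + e → mono a b c e ∈ S) (f : Ham0) : f ∈ S := by
  have h0 : ∀ μ ∈ (f : Poly).support, 2 ≤ μ 0 + μ 1 + μ 2 + μ 3 := by
    intro μ hμ
    by_contra hlt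
    rw [mem_support_iff] at hμ
    apply hμ
    by_cases hz : μ = 0
    · rw [hz, ← constantCoeff_eq]; exact f.2.1
    · obtain ⟨i, hi⟩ : ∃ i, μ i ≠ 0 := by
        by_contra hh; push Not at hh; exact hz (Finsupp.ext hh)
      have hm : μ = Finsupp.single i 1 := by
        ext j
        rw [Finsupp.single_apply]
        have key : μ 0 + μ 1 + μ 2 + μ 3 ≤ 1 := by omega
        fin_cases i <;> fin_cases j <;> simp at hi ⊢ <;> omega
      have := f.2.2 i
      rw [constantCoeff_eq, coeff_pderiv] at this
      simpa [hm] using this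
  have h1 : f = ∑ μ ∈ (f : Poly).support,
      ((f : Poly).coeff μ * ((μ 0).factorial * (μ 1).factorial * (μ 2).factorial *
        (μ 3).factorial)) • mono (μ 0) (μ 1) (μ 2) (μ 3) := by
    ext1
    conv_lhs => rw [(f : Poly).as_sum]
    rw [Submodule.coe_sum]
    refine Finset.sum_congr rfl fun μ hμ => ?_
    rw [Submodule.coe_smul, coe_mono (h0 μ hμ), basisPoly, smul_monomial]
    congr 2
    · ext i; fin_cases i <;> simp
    · simp; field_simp
  rw [h1]
  exact S.sum_mem fun μ hμ => S.smul_mem _ (h _ _ _ _ (h0 μ hμ))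

/-- A form is zero if it vanishes on all tuples of basis elements. -/
theorem cochain_eq_zero {m : ℕ} (σ : Cochain Ham0 m)
    (h : ∀ α : Fin m → Fin 4 → ℕ, (∀ i, 2 ≤ α i 0 + α i 1 + α i 2 + α i 3) →
      σ (fun i => mono (α i 0) (α i 1) (α i 2) (α i 3)) = 0) : σ = 0 := by
  induction m with
  | zero =>
    ext v
    rw [AlternatingMap.zero_apply, ← h (fun i => i.elim0) (fun i => i.elim0)]
    congr 1
    ext i
    exact i.elim0
  | succ m ih =>
    refine ext_curryLeft fun x => ?_
    refine span_mono (LinearMap.ker σ.curryLeft) (fun a b c e hs => ?_) x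
    refine ih _ fun α hα => ?_
    rw [AlternatingMap.curryLeft_apply_apply, ← h (Fin.cons ![a, b, c, e] α)
      (fun i => by
        refine Fin.cases ?_ (fun i => ?_) i
        · simpa using hs
        · simpa using hα i)]
    congr 1
    funext i
    refine Fin.cases ?_ (fun i => ?_) i
    · simp
    · simp

/-! ### Relative cochains -/

variable {m : ℕ} {w : ℤ}

/-- By Cartan's formula the relative cochains are the horizontal invariant ones. -/
theorem mem_relCochain_succ {σ : Cochain Ham0 (m + 1)} :
    σ ∈ relCochain (m + 1) w ↔ σ ∈ weightCochain (m + 1) w ∧ ∀ ξ : sp4,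
      σ.curryLeft (momentum ξ) = 0 ∧ derivForm (momentum ξ) σ = 0 := by
  refine and_congr Iff.rfl (forall_congr' fun ξ => and_congr_right fun h => ?_)
  have h' : σ.curryLeft (momentum ξ) = 0 := h
  change (d σ).curryLeft (momentum ξ) = 0 ↔ _
  rw [curryLeft_d, h', map_zero, sub_zero, neg_eq_zero]

/-- Relative cochains are annihilated by all quadratic arguments. -/
theorem relCochain_curryLeft {σ : Cochain Ham0 (m + 1)} (hσ : σ ∈ relCochain (m + 1) w)
    {a b c e : ℕ} (h : a + b + c + e = 2) : σ.curryLeft (mono a b c e) = 0 := by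
  obtain ⟨ξ, hξ⟩ := exists_momentum_eq (mono a b c e) (h ▸ isHomogeneous_mono a b c e)
  rw [← hξ]
  exact ((mem_relCochain_succ.1 hσ).2 ξ).1

theorem relCochain_invariant {σ : Cochain Ham0 (m + 1)} (hσ : σ ∈ relCochain (m + 1) w)
    (a b c e : ℕ) (h : a + b + c + e = 2 := by norm_num) : derivForm (mono a b c e) σ = 0 := by
  obtain ⟨ξ, hξ⟩ := exists_momentum_eq (mono a b c e) (h ▸ isHomogeneous_mono a b c e)
  rw [← hξ]
  exact ((mem_relCochain_succ.1 hσ).2 ξ).2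

/-- A relative cochain vanishes on a tuple of basis elements unless their degrees are at least `3`
and add up to `w + 2 m`. -/
theorem relCochain_apply_eq_zero {σ : Cochain Ham0 (m + 1)} (hσ : σ ∈ relCochain (m + 1) w)
    (α : Fin (m + 1) → Fin 4 → ℕ)
    (h : (∀ i, 3 ≤ α i 0 + α i 1 + α i 2 + α i 3) →
      ∑ i, ((α i 0 + α i 1 + α i 2 + α i 3 : ℕ) - 2 : ℤ) ≠ w) :
    σ (fun i => mono (α i 0) (α i 1) (α i 2) (α i 3)) = 0 := by
  by_cases h3 : ∀ i, 3 ≤ α i 0 + α i 1 + α i 2 + α i 3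
  · exact hσ.1 _ _ (fun i => isHomogeneous_mono _ _ _ _) (h h3)
  · push Not at h3
    obtain ⟨i, hi⟩ := h3
    rcases (Nat.lt_succ_iff_lt_or_eq.1 hi) with hi | hi
    · exact σ.map_coord_zero i (mono_of_lt hi)
    · exact apply_eq_zero_of_curryLeft σ _ i (relCochain_curryLeft hσ hi)

/-- Each argument contributes at least `1` to the weight. -/
theorem relCochain_eq_bot (h : w < m) : relCochain m w = ⊥ := by
  rw [eq_bot_iff]
  intro σ hσ
  rw [Submodule.mem_bot]
  rcases m with _ | m
  · ext v
    exact hσ.1 (fun i => i.elim0) v (fun i => i.elim0) (by simpa using h.ne')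
  · refine cochain_eq_zero σ fun α _ => relCochain_apply_eq_zero hσ α fun h3 => ?_
    have : ∑ i : Fin (m + 1), (1 : ℤ) ≤ ∑ i, ((α i 0 + α i 1 + α i 2 + α i 3 : ℕ) - 2 : ℤ) :=
      Finset.sum_le_sum fun i _ => by have := h3 i; omega
    rw [Finset.sum_const, Finset.card_univ, Fintype.card_fin, nsmul_eq_mul, mul_one] at this
    exact (h.trans_le this).ne'

/-! ### Homogeneous polynomials generated by one monomial -/

theorem smul_mem_cancel {K : Submodule ℝ Ham0} {n : ℕ} {x : Ham0}
    (h : ((n + 1 : ℕ) : ℝ) • x ∈ K) : x ∈ K :=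
  (K.smul_mem_iff (by positivity)).1 h

/-- A subspace stable under `x₂ ∂₃` contains with the monomials free of `x₂` all others. -/
theorem mono_mem_of_0200 {K : Submodule ℝ Ham0} (h : ∀ x ∈ K, ⁅mono 0 2 0 0, x⁆ ∈ K) {a n e : ℕ}
    (h0 : mono a 0 n e ∈ K) (b c : ℕ) (hn : b + c = n) : mono a b c e ∈ K := by
  induction b generalizing c with
  | zero => simpa [← hn] using h0
  | succ b ih =>
    have := h _ (ih (c + 1) (by omega))
    rw [lie_0200, if_neg (by omega)] at this
    exact smul_mem_cancel this

/-- A subspace stable under `x₃ ∂₂` contains with the monomials free of `x₃` all others. -/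
theorem mono_mem_of_0020 {K : Submodule ℝ Ham0} (h : ∀ x ∈ K, ⁅mono 0 0 2 0, x⁆ ∈ K) {a n e : ℕ}
    (h0 : mono a n 0 e ∈ K) (b c : ℕ) (hn : b + c = n) : mono a b c e ∈ K := by
  induction c generalizing b with
  | zero => simpa [← hn] using h0
  | succ c ih =>
    have := h _ (ih (b + 1) (by omega))
    rw [lie_0020, if_neg (by omega), neg_mem_iff] at this
    exact smul_mem_cancel this

/-- The homogeneous polynomials of degree `n` are generated by the power of `x₁` under lowering
operators. -/
theorem mono_mem_of_lowering {K : Submodule ℝ Ham0} (h1 : ∀ x ∈ K, ⁅mono 0 0 1 1, x⁆ ∈ K)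
    (h2 : ∀ x ∈ K, ⁅mono 0 0 0 2, x⁆ ∈ K) (h3 : ∀ x ∈ K, ⁅mono 0 2 0 0, x⁆ ∈ K) {n : ℕ}
    (h0 : mono n 0 0 0 ∈ K) (a b c e : ℕ) (hn : a + b + c + e = n) : mono a b c e ∈ K := by
  -- On monomials free of `x₂`, the bracket with `x₃ x₄` is `-x₃ ∂₁`.
  have hc : ∀ c a, a + c = n → mono a 0 c 0 ∈ K := by
    intro c
    induction c with
    | zero => intro a ha; simpa [← ha] using h0
    | succ c ih =>
      intro a ha
      have := h1 _ (ih (a + 1) (by omega))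
      rw [lie_0011, if_pos rfl, if_neg (by omega), neg_zero, zero_sub, neg_mem_iff] at this
      exact smul_mem_cancel this
  have he : ∀ e a c, a + c + e = n → mono a 0 c e ∈ K := by
    intro e
    induction e with
    | zero => intro a c ha; exact hc c a ha
    | succ e ih =>
      intro a c ha
      have := h2 _ (ih (a + 1) c (by omega))
      rw [lie_0002, if_neg (by omega), neg_mem_iff] at this
      exact smul_mem_cancel this
  exact mono_mem_of_0200 h3 (he e a (b + c) (by omega)) b c rfl

/-- The homogeneous polynomials of degree `n` are generated by the power of `x₄` under the
operators that fix `x₁` up to a factor. -/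
theorem mono_mem_of_raising {K : Submodule ℝ Ham0} (h1 : ∀ x ∈ K, ⁅mono 1 0 1 0, x⁆ ∈ K)
    (h2 : ∀ x ∈ K, ⁅mono 2 0 0 0, x⁆ ∈ K) (h3 : ∀ x ∈ K, ⁅mono 0 2 0 0, x⁆ ∈ K) {n : ℕ}
    (h0 : mono 0 0 0 n ∈ K) (a b c e : ℕ) (hn : a + b + c + e = n) : mono a b c e ∈ K := by
  -- On monomials free of `x₂`, the bracket with `x₁ x₃` is `x₃ ∂₄`.
  have hc : ∀ c e, c + e = n → mono 0 0 c e ∈ K := by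
    intro c
    induction c with
    | zero => intro e he; simpa [← he] using h0
    | succ c ih =>
      intro e he
      have := h1 _ (ih (e + 1) (by omega))
      rw [lie_1010, if_pos rfl, if_neg (by omega), sub_zero] at this
      exact smul_mem_cancel this
  have ha : ∀ a c e, a + c + e = n → mono a 0 c e ∈ K := by
    intro a
    induction a with
    | zero => intro c e he; exact hc c e (by omega)
    | succ a ih =>
      intro c e he
      have := h2 _ (ih c (e + 1) (by omega))
      rw [lie_2000, if_neg (by omega)] at this
      exact smul_mem_cancel this
  exact mono_mem_of_0200 h3 (ha a (b + c) e (by omega)) b c rfl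

/-! ### Reduction to coefficients on a slice -/

theorem derivForm_map_zero (q : Ham0) : derivForm q (0 : Cochain Ham0 m) = 0 := by
  ext v; simp [derivForm_apply]

/-- The arguments that annihilate a form invariant under `q` are stable under `q`. -/
theorem lie_mem_ker_curryLeft {τ : Cochain Ham0 (m + 1)} {q : Ham0} (h : derivForm q τ = 0)
    (x : Ham0) (hx : x ∈ LinearMap.ker τ.curryLeft) : ⁅q, x⁆ ∈ LinearMap.ker τ.curryLeft := by
  rw [LinearMap.mem_ker] at hx ⊢
  have := curryLeft_derivForm q x τ
  rw [h, hx, derivForm_map_zero, add_zero] at this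
  exact this.symm

/-- Contracting an eigenvector with an eigenvector gives an eigenvector. -/
theorem derivForm_curryLeft {τ : Cochain Ham0 (m + 1)} {q x : Ham0} {r s : ℝ}
    (h : derivForm q τ = r • τ) (hx : ⁅q, x⁆ = s • x) :
    derivForm q (τ.curryLeft x) = (r - s) • τ.curryLeft x := by
  have := curryLeft_derivForm q x τ
  rw [h, hx, map_smul] at this
  ext v
  have h2 := congrArg (fun ρ => ρ v) this
  simp only [AlternatingMap.curryLeft_smul, LinearMap.smul_apply, AlternatingMap.smul_apply,
    AlternatingMap.add_apply, smul_eq_mul] at h2 ⊢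
  linarith

theorem derivForm_curryLeft_zero {τ : Cochain Ham0 (m + 1)} {q x : Ham0}
    (h : derivForm q τ = 0) (hx : ⁅q, x⁆ = 0) : derivForm q (τ.curryLeft x) = 0 := by
  have := curryLeft_derivForm q x τ
  rw [h, hx, map_zero, zero_add] at this
  exact this.symm

/-- Fully contracted, an eigenvector of non-zero eigenvalue vanishes. -/
theorem eq_zero_of_eigen {τ : Cochain Ham0 0} {q : Ham0} {r : ℝ} (h : derivForm q τ = r • τ)
    (hr : r ≠ 0) : τ = 0 := by
  rw [derivForm_zero] at h
  exact (smul_eq_zero.1 h.symm).resolve_left hr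

/-- `τ` vanishes on a tuple of basis elements unless their degrees `ℓᵢ` are at least `3` and
`∑ (ℓᵢ - 2) = w`. -/
def Concentrated (τ : Cochain Ham0 m) (w : ℤ) : Prop :=
  ∀ α : Fin m → Fin 4 → ℕ, ((∀ i, 3 ≤ α i 0 + α i 1 + α i 2 + α i 3) →
      ∑ i, ((α i 0 + α i 1 + α i 2 + α i 3 : ℕ) - 2 : ℤ) ≠ w) →
    τ (fun i => mono (α i 0) (α i 1) (α i 2) (α i 3)) = 0

theorem Concentrated.curryLeft {τ : Cochain Ham0 (m + 1)} (h : Concentrated τ w)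
    (a b c e : ℕ) :
    Concentrated (τ.curryLeft (mono a b c e)) (w - ((a + b + c + e : ℕ) - 2)) := by
  intro α hα
  rw [AlternatingMap.curryLeft_apply_apply, ← h (Fin.cons ![a, b, c, e] α) (fun h3 => ?_)]
  · congr 1
    funext i
    refine Fin.cases ?_ (fun i => ?_) i
    · simp
    · simp
  · have := hα fun i => by simpa using h3 i.succ
    rw [Fin.sum_univ_succ]
    simp only [Fin.cons_succ, Fin.cons_zero]
    intro h4
    apply this
    rw [← h4]
    simp

/-- To show that a concentrated form vanishes it suffices to contract it with the basis elements of
one degree, if every admissible sequence of degrees contains this degree. -/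
theorem Concentrated.eq_zero {τ : Cochain Ham0 (m + 1)} (h : Concentrated τ w) (P : ℕ → Prop)
    (hP : ∀ ℓ : Fin (m + 1) → ℕ, (∀ i, 3 ≤ ℓ i) → ∑ i, ((ℓ i : ℤ) - 2) = w → ∃ i, P (ℓ i))
    (h' : ∀ a b c e, P (a + b + c + e) → τ.curryLeft (mono a b c e) = 0) : τ = 0 := by
  refine cochain_eq_zero τ fun α _ => ?_
  by_cases h3 : (∀ i, 3 ≤ α i 0 + α i 1 + α i 2 + α i 3) ∧
      ∑ i, ((α i 0 + α i 1 + α i 2 + α i 3 : ℕ) - 2 : ℤ) = w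
  · obtain ⟨i, hi⟩ := hP _ h3.1 h3.2
    exact apply_eq_zero_of_curryLeft τ _ i (h' _ _ _ _ hi)
  · exact h α fun h4 h5 => h3 ⟨h4, h5⟩

theorem concentrated_of_mem {σ : Cochain Ham0 (m + 1)} (hσ : σ ∈ relCochain (m + 1) w) :
    Concentrated σ w := fun α h => relCochain_apply_eq_zero hσ α h

/-- A form invariant under lowering operators that is annihilated by a power of `x₁` is annihilated
by all polynomials of the same degree. -/
theorem curryLeft_eq_zero_of_lowering {σ : Cochain Ham0 (m + 1)} (hσ : σ ∈ relCochain (m + 1) w)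
    {n : ℕ} (h : σ.curryLeft (mono n 0 0 0) = 0) (a b c e : ℕ) (hn : a + b + c + e = n) :
    σ.curryLeft (mono a b c e) = 0 :=
  mono_mem_of_lowering (K := LinearMap.ker σ.curryLeft)
    (lie_mem_ker_curryLeft (relCochain_invariant hσ 0 0 1 1))
    (lie_mem_ker_curryLeft (relCochain_invariant hσ 0 0 0 2))
    (lie_mem_ker_curryLeft (relCochain_invariant hσ 0 2 0 0)) h a b c e hn

/-- Once the first argument is a power of `x₁`, the vanishing in the second argument can be tested
on a power of `x₄`. -/
theorem curryLeft_eq_zero_of_raising {σ : Cochain Ham0 (m + 2)} (hσ : σ ∈ relCochain (m + 2) w)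
    {k n : ℕ} (h : (σ.curryLeft (mono k 0 0 0)).curryLeft (mono 0 0 0 n) = 0) (a b c e : ℕ)
    (hn : a + b + c + e = n) : (σ.curryLeft (mono k 0 0 0)).curryLeft (mono a b c e) = 0 :=
  mono_mem_of_raising (K := LinearMap.ker (σ.curryLeft (mono k 0 0 0)).curryLeft)
    (lie_mem_ker_curryLeft (derivForm_curryLeft_zero (relCochain_invariant hσ 1 0 1 0)
      (by simp [lie_1010])))
    (lie_mem_ker_curryLeft (derivForm_curryLeft_zero (relCochain_invariant hσ 2 0 0 0)
      (by simp [lie_2000])))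
    (lie_mem_ker_curryLeft (derivForm_curryLeft_zero (relCochain_invariant hσ 0 2 0 0)
      (by simp [lie_0200]))) h a b c e hn

/-! ### Uniqueness in degrees one to three -/

/-- A relative `1`-cochain vanishes, as the torus acts on powers of `x₁` without invariants. -/
theorem relCochain_one : relCochain 1 4 = ⊥ := by
  rw [eq_bot_iff]
  intro σ hσ
  rw [Submodule.mem_bot]
  refine (concentrated_of_mem hσ).eq_zero (· = 6) (fun ℓ h3 hℓ => ⟨0, ?_⟩)
    (curryLeft_eq_zero_of_lowering hσ ?_)
  · simp at hℓ; omega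
  · refine eq_zero_of_eigen (derivForm_curryLeft (q := mono 1 0 0 1) (r := 0)
      (by rw [relCochain_invariant hσ 1 0 0 1, zero_smul]) (lie_1001 6 0 0 0)) (by norm_num)

/-- The operator `x₁ ∂₄` moves the coefficient at `(x₁⁴, x₄⁴)` to the one at `(x₁² x₄², x₁² x₄²)`,
which vanishes by alternation. -/
theorem relCochain_two_curryLeft {σ : Cochain Ham0 2} (hσ : σ ∈ relCochain 2 4) :
    (σ.curryLeft (mono 4 0 0 0)).curryLeft (mono 0 0 0 4) = 0 := by
  have hq := relCochain_invariant hσ 2 0 0 0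
  have h1 := congrArg (fun ρ => ((ρ.curryLeft (mono 3 0 0 1)).curryLeft (mono 0 0 0 4))) hq
  have h2 := congrArg (fun ρ => ((ρ.curryLeft (mono 2 0 0 2)).curryLeft (mono 1 0 0 3))) hq
  simp only [curryLeft_derivForm, lie_2000, AlternatingMap.curryLeft_add, LinearMap.add_apply,
    derivForm_zero, AlternatingMap.curryLeft_zero, LinearMap.zero_apply] at h1 h2
  norm_num at h1 h2
  rw [h2] at h1
  simpa using h1

/-- Here the degrees are `3, 5` or `4, 4`. -/
theorem relCochain_two : relCochain 2 4 = ⊥ := by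
  rw [eq_bot_iff]
  intro σ hσ
  rw [Submodule.mem_bot]
  have h5 : ∀ a b c e, a + b + c + e = 5 → σ.curryLeft (mono a b c e) = 0 := by
    refine curryLeft_eq_zero_of_lowering hσ ?_
    refine ((concentrated_of_mem hσ).curryLeft 5 0 0 0).eq_zero (· = 3)
      (fun ℓ h3 hℓ => ⟨0, ?_⟩) (curryLeft_eq_zero_of_raising hσ ?_)
    · simp at hℓ; omega
    · exact eq_zero_of_eigen (derivForm_curryLeft (derivForm_curryLeft (q := mono 1 0 0 1) (r := 0)
        (by rw [relCochain_invariant hσ 1 0 0 1, zero_smul]) (lie_1001 5 0 0 0))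
        (lie_1001 0 0 0 3)) (by norm_num)
  have h4 : ∀ a b c e, a + b + c + e = 4 → σ.curryLeft (mono a b c e) = 0 := by
    refine curryLeft_eq_zero_of_lowering hσ ?_
    refine ((concentrated_of_mem hσ).curryLeft 4 0 0 0).eq_zero (· = 4)
      (fun ℓ h3 hℓ => ⟨0, ?_⟩) (curryLeft_eq_zero_of_raising hσ (relCochain_two_curryLeft hσ))
    simp at hℓ; omega
  refine (concentrated_of_mem hσ).eq_zero (fun n => n = 4 ∨ n = 5) (fun ℓ h3 hℓ => ?_)
    (fun a b c e h => h.elim (h4 a b c e) (h5 a b c e))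
  rw [Fin.sum_univ_two] at hℓ
  have := h3 0
  have := h3 1
  by_cases h : ℓ 0 = 3
  · exact ⟨1, by omega⟩
  · exact ⟨0, by omega⟩

/-- A relative `3`-cochain is determined by a single coefficient. -/
theorem relCochain_three_eq_zero {σ : Cochain Ham0 3} (hσ : σ ∈ relCochain 3 4)
    (h : σ ![mono 4 0 0 0, mono 0 0 0 3, mono 1 0 0 2] = 0) : σ = 0 := by
  refine (concentrated_of_mem hσ).eq_zero (· = 4) (fun ℓ h3 hℓ => ?_)
    (curryLeft_eq_zero_of_lowering hσ ?_)
  · rw [Fin.sum_univ_three] at hℓ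
    have := h3 0
    have := h3 1
    have := h3 2
    by_cases h0 : ℓ 0 = 4
    · exact ⟨0, h0⟩
    · by_cases h1 : ℓ 1 = 4
      · exact ⟨1, h1⟩
      · exact ⟨2, by omega⟩
  refine ((concentrated_of_mem hσ).curryLeft 4 0 0 0).eq_zero (· = 3)
    (fun ℓ h3 hℓ => ⟨0, ?_⟩) (curryLeft_eq_zero_of_raising hσ ?_)
  · rw [Fin.sum_univ_two] at hℓ
    have := h3 0
    have := h3 1
    simp at hℓ
    omega
  set τ := (σ.curryLeft (mono 4 0 0 0)).curryLeft (mono 0 0 0 3) with hτ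
  refine (((concentrated_of_mem hσ).curryLeft 4 0 0 0).curryLeft 0 0 0 3).eq_zero (· = 3)
    (fun ℓ h3 hℓ => ⟨0, ?_⟩) (fun a b c e habce => ?_)
  · simp at hℓ
    omega
  refine mono_mem_of_0200 (K := LinearMap.ker τ.curryLeft) (lie_mem_ker_curryLeft
    (derivForm_curryLeft_zero (derivForm_curryLeft_zero (relCochain_invariant hσ 0 2 0 0)
      (by simp [lie_0200])) (by simp [lie_0200]))) (n := b + c) ?_ b c rfl
  have ht := derivForm_curryLeft (derivForm_curryLeft (derivForm_curryLeft (q := mono 1 0 0 1)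
    (r := 0) (by rw [relCochain_invariant hσ 1 0 0 1, zero_smul]) (lie_1001 4 0 0 0))
        (lie_1001 0 0 0 3)) (lie_1001 a 0 (b + c) e)
  have ht' := derivForm_curryLeft (derivForm_curryLeft (derivForm_curryLeft (q := mono 0 1 1 0)
    (r := 0) (by rw [relCochain_invariant hσ 0 1 1 0, zero_smul]) (lie_0110 4 0 0 0))
        (lie_0110 0 0 0 3)) (lie_0110 a 0 (b + c) e)
  rw [LinearMap.mem_ker]
  by_contra hne
  have h1 : (e : ℝ) = a + 1 := by
    by_contra h2
    refine hne (eq_zero_of_eigen ht fun h3 => h2 ?_)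
    push_cast at h3
    linarith
  have h2 : ((b + c : ℕ) : ℝ) = 0 := by
    by_contra h2
    refine hne (eq_zero_of_eigen ht' fun h3 => h2 ?_)
    push_cast at h3 ⊢
    linarith
  norm_cast at h1 h2
  obtain ⟨rfl, rfl, rfl, rfl⟩ : a = 1 ∧ b = 0 ∧ c = 0 ∧ e = 2 := by omega
  apply hne
  ext v
  rw [hτ, AlternatingMap.zero_apply, ← h, Subsingleton.elim v ![]]
  rfl

/-! ### Uniqueness in degree four -/

section Four

/-- The value of a `4`-form, written with iterated contractions. -/
theorem apply_four (σ : Cochain Ham0 4) (x y z t : Ham0) :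
    σ ![x, y, z, t] = (((σ.curryLeft x).curryLeft y).curryLeft z).curryLeft t ![] := rfl

theorem swap_one_two (σ : Cochain Ham0 4) (x y z t : Ham0) :
    σ ![x, z, y, t] = -σ ![x, y, z, t] := by
  rw [apply_four, apply_four, curryLeft_swap _ z y]
  rfl

theorem swap_two_three (σ : Cochain Ham0 4) (x y z t : Ham0) :
    σ ![x, y, t, z] = -σ ![x, y, z, t] := by
  rw [apply_four, apply_four, curryLeft_swap]
  rfl

/-- Invariance of a `4`-form, written out. -/
theorem sum_lie_eq_zero {σ : Cochain Ham0 4} {q : Ham0} (h : derivForm q σ = 0)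
    (x y z t : Ham0) :
    σ ![⁅q, x⁆, y, z, t] + σ ![x, ⁅q, y⁆, z, t] + σ ![x, y, ⁅q, z⁆, t] + σ ![x, y, z, ⁅q, t⁆] =
      0 := by
  have := congrArg (fun ρ => ρ ![x, y, z, t]) h
  have e0 : ∀ u, Function.update ![x, y, z, t] 0 u = ![u, y, z, t] := fun u => by
    funext i; fin_cases i <;> rfl
  have e1 : ∀ u, Function.update ![x, y, z, t] 1 u = ![x, u, z, t] := fun u => by
    funext i; fin_cases i <;> rfl
  have e2 : ∀ u, Function.update ![x, y, z, t] 2 u = ![x, y, u, t] := fun u => by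
    funext i; fin_cases i <;> rfl
  have e3 : ∀ u, Function.update ![x, y, z, t] 3 u = ![x, y, z, u] := fun u => by
    funext i; fin_cases i <;> rfl
  simp only [derivForm_apply, Fin.sum_univ_four, e0, e1, e2, e3] at this
  exact this

theorem apply_four_smul₀ (σ : Cochain Ham0 4) (r : ℝ) (x y z t : Ham0) :
    σ ![r • x, y, z, t] = r * σ ![x, y, z, t] := by
  rw [apply_four, apply_four, map_smul]; rfl

theorem apply_four_smul₂ (σ : Cochain Ham0 4) (r : ℝ) (x y z t : Ham0) :
    σ ![x, y, r • z, t] = r * σ ![x, y, z, t] := by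
  rw [apply_four, apply_four, map_smul]; rfl

theorem apply_four_smul₃ (σ : Cochain Ham0 4) (r : ℝ) (x y z t : Ham0) :
    σ ![x, y, z, r • t] = r * σ ![x, y, z, t] := by
  rw [apply_four, apply_four, map_smul]; rfl

theorem apply_four_add₃ (σ : Cochain Ham0 4) (x y z t t' : Ham0) :
    σ ![x, y, z, t + t'] = σ ![x, y, z, t] + σ ![x, y, z, t'] := by
  simp only [apply_four, map_add]; rfl

theorem apply_four_zero₀ (σ : Cochain Ham0 4) (y z t : Ham0) : σ ![0, y, z, t] = 0 :=
  σ.map_coord_zero 0 rfl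

theorem apply_four_zero₁ (σ : Cochain Ham0 4) (x z t : Ham0) : σ ![x, 0, z, t] = 0 :=
  σ.map_coord_zero 1 rfl

theorem apply_four_zero₃ (σ : Cochain Ham0 4) (x y z : Ham0) : σ ![x, y, z, 0] = 0 :=
  σ.map_coord_zero 3 rfl

theorem apply_four_neg₂ (σ : Cochain Ham0 4) (x y z t : Ham0) :
    σ ![x, y, -z, t] = -σ ![x, y, z, t] := by
  rw [apply_four, apply_four, map_neg]; rfl

theorem apply_four_neg₃ (σ : Cochain Ham0 4) (x y z t : Ham0) :
    σ ![x, y, z, -t] = -σ ![x, y, z, t] := by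
  rw [apply_four, apply_four, map_neg]; rfl

theorem apply_four_eq (σ : Cochain Ham0 4) (x y z : Ham0) :
    σ ![x, x, y, z] = 0 ∧ σ ![x, y, x, z] = 0 ∧ σ ![x, y, z, x] = 0 ∧ σ ![y, x, x, z] = 0 ∧
      σ ![y, x, z, x] = 0 ∧ σ ![y, z, x, x] = 0 := by
  refine ⟨σ.map_eq_zero_of_eq _ (i := 0) (j := 1) rfl ?_,
    σ.map_eq_zero_of_eq _ (i := 0) (j := 2) rfl ?_, σ.map_eq_zero_of_eq _ (i := 0) (j := 3) rfl ?_,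
    σ.map_eq_zero_of_eq _ (i := 1) (j := 2) rfl ?_, σ.map_eq_zero_of_eq _ (i := 1) (j := 3) rfl ?_,
    σ.map_eq_zero_of_eq _ (i := 2) (j := 3) rfl ?_⟩ <;> decide

/-- The values of a `4`-form on the slice of tuples that remain after normalising the first two
arguments to powers of `x₁` and `x₄`, and removing `x₂` from the third and `x₃` from the fourth. -/
noncomputable def sliceCoeff (σ : Cochain Ham0 4) (i j k : ℕ) : ℝ :=
  σ ![mono 3 0 0 0, mono 0 0 0 3, mono i 0 j k, mono k j 0 i]

/-- A relative `4`-cochain is determined by its values on the slice. -/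
theorem relCochain_four_eq_zero_of_slice {σ : Cochain Ham0 4} (hσ : σ ∈ relCochain 4 4)
    (h : ∀ i j k, i + j + k = 3 → sliceCoeff σ i j k = 0) : σ = 0 := by
  have hc := concentrated_of_mem hσ
  refine hc.eq_zero (· = 3) (fun ℓ h3 hℓ => ⟨0, ?_⟩) (curryLeft_eq_zero_of_lowering hσ ?_)
  · rw [Fin.sum_univ_four] at hℓ
    have := h3 0
    have := h3 1
    have := h3 2
    have := h3 3
    omega
  have hc := hc.curryLeft 3 0 0 0
  refine hc.eq_zero (· = 3) (fun ℓ h3 hℓ => ⟨0, ?_⟩) (curryLeft_eq_zero_of_raising hσ ?_)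
  · rw [Fin.sum_univ_three] at hℓ
    have := h3 0
    have := h3 1
    have := h3 2
    simp at hℓ
    omega
  have hc := hc.curryLeft 0 0 0 3
  set τ := (σ.curryLeft (mono 3 0 0 0)).curryLeft (mono 0 0 0 3) with hτ
  refine hc.eq_zero (· = 3) (fun ℓ h3 hℓ => ⟨0, ?_⟩) (fun a b c e habce => ?_)
  · rw [Fin.sum_univ_two] at hℓ
    have := h3 0
    have := h3 1
    simp at hℓ
    omega
  refine mono_mem_of_0200 (K := LinearMap.ker τ.curryLeft) (lie_mem_ker_curryLeft
    (derivForm_curryLeft_zero (derivForm_curryLeft_zero (relCochain_invariant hσ 0 2 0 0)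
      (by simp [lie_0200])) (by simp [lie_0200]))) (n := b + c) ?_ b c rfl
  rw [LinearMap.mem_ker]
  obtain ⟨j, hj⟩ : ∃ j, b + c = j := ⟨_, rfl⟩
  rw [hj]
  have hc := hc.curryLeft a 0 j e
  set ρ := τ.curryLeft (mono a 0 j e) with hρ
  refine hc.eq_zero (· = 3) (fun ℓ h3 hℓ => ⟨0, ?_⟩) (fun a' b' c' e' habce' => ?_)
  · simp at hℓ
    have : a + j + e = 3 := by omega
    zify at this
    omega
  refine mono_mem_of_0020 (K := LinearMap.ker ρ.curryLeft) (lie_mem_ker_curryLeft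
    (derivForm_curryLeft_zero (derivForm_curryLeft_zero (derivForm_curryLeft_zero
      (relCochain_invariant hσ 0 0 2 0) (by simp [lie_0020])) (by simp [lie_0020]))
      (by simp [lie_0020]))) (n := b' + c') ?_ b' c' rfl
  rw [LinearMap.mem_ker]
  have ht := derivForm_curryLeft (derivForm_curryLeft (derivForm_curryLeft (derivForm_curryLeft
    (q := mono 1 0 0 1) (r := 0) (by rw [relCochain_invariant hσ 1 0 0 1, zero_smul])
      (lie_1001 3 0 0 0)) (lie_1001 0 0 0 3)) (lie_1001 a 0 j e)) (lie_1001 a' (b' + c') 0 e')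
  have ht' := derivForm_curryLeft (derivForm_curryLeft (derivForm_curryLeft (derivForm_curryLeft
    (q := mono 0 1 1 0) (r := 0) (by rw [relCochain_invariant hσ 0 1 1 0, zero_smul])
      (lie_0110 3 0 0 0)) (lie_0110 0 0 0 3)) (lie_0110 a 0 j e)) (lie_0110 a' (b' + c') 0 e')
  by_contra hne
  have h1 : (e + e' : ℝ) = a + a' := by
    by_contra h2
    refine hne (eq_zero_of_eigen ht fun h3 => h2 ?_)
    push_cast at h3
    linarith
  have h2 : ((b' + c' : ℕ) : ℝ) = j := by
    by_contra h2
    refine hne (eq_zero_of_eigen ht' fun h3 => h2 ?_)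
    push_cast at h3 ⊢
    linarith
  norm_cast at h1 h2
  obtain ⟨rfl, rfl⟩ : a' = e ∧ e' = a := by omega
  apply hne
  ext v
  rw [AlternatingMap.zero_apply, ← h e' j a' (by omega), Subsingleton.elim v ![], h2]
  rfl

/-- The relations among the values on the slice that follow from alternation and invariance. -/
theorem sliceCoeff_relations {σ : Cochain Ham0 4} (hσ : σ ∈ relCochain 4 4) :
    sliceCoeff σ 0 0 3 = 0 ∧ sliceCoeff σ 3 0 0 = 0 ∧ sliceCoeff σ 2 0 1 = -sliceCoeff σ 1 0 2 ∧
      sliceCoeff σ 0 1 2 = -sliceCoeff σ 1 2 0 ∧ sliceCoeff σ 2 1 0 = -sliceCoeff σ 1 2 0 ∧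
      sliceCoeff σ 0 2 1 = -sliceCoeff σ 1 2 0 ∧
      sliceCoeff σ 1 1 1 = sliceCoeff σ 1 0 2 + sliceCoeff σ 1 2 0 := by
  -- `r1` relates `(2, 1, 0)` to `(1, 2, 0)`, `r2` relates `(2, 1, 0)` to `(0, 1, 2)`, `r3` and `r3'` relate
  -- `(0, 2, 1)` to `(1, 2, 0)`, and `r4`, `r5`, `r6` express `(1, 1, 1)`.
  have h20 := relCochain_invariant hσ 0 0 2 0
  have h11 := relCochain_invariant hσ 1 1 0 0
  have h2000 := relCochain_invariant hσ 2 0 0 0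
  have r1 := sum_lie_eq_zero h11 (mono 3 0 0 0) (mono 0 0 0 3) (mono 1 0 2 0) (mono 0 1 0 2)
  have r2 := sum_lie_eq_zero h20 (mono 3 0 0 0) (mono 0 0 0 3) (mono 2 1 0 0) (mono 0 1 0 2)
  have r3 := sum_lie_eq_zero h20 (mono 3 0 0 0) (mono 0 0 0 3) (mono 1 2 0 0) (mono 0 1 1 1)
  have r3' := sum_lie_eq_zero h20 (mono 3 0 0 0) (mono 0 0 0 3) (mono 1 1 1 0) (mono 0 2 0 1)
  have r4 := sum_lie_eq_zero h2000 (mono 3 0 0 0) (mono 0 0 0 3) (mono 1 0 1 1) (mono 0 1 0 2)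
  have r5 := sum_lie_eq_zero h11 (mono 3 0 0 0) (mono 0 0 0 3) (mono 1 0 0 2) (mono 1 0 1 1)
  have r6 := sum_lie_eq_zero h2000 (mono 2 0 0 1) (mono 0 0 0 3) (mono 1 0 0 2) (mono 1 1 1 0)
  have s1 := swap_two_three σ (mono 3 0 0 0) (mono 0 0 0 3) (mono 1 0 0 2) (mono 2 0 0 1)
  have s2 := swap_two_three σ (mono 3 0 0 0) (mono 0 0 0 3) (mono 0 0 1 2) (mono 2 1 0 0)
  have s3 := swap_two_three σ (mono 3 0 0 0) (mono 0 0 0 3) (mono 0 0 2 1) (mono 1 2 0 0)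
  have s4 := swap_one_two σ (mono 3 0 0 0) (mono 0 1 0 2) (mono 1 0 0 2) (mono 1 0 1 1)
  have s5 := swap_two_three σ (mono 3 0 0 0) (mono 1 0 0 2) (mono 0 1 0 2) (mono 1 0 1 1)
  have s6 := swap_two_three σ (mono 3 0 0 0) (mono 0 0 0 3) (mono 1 0 1 1) (mono 1 1 0 1)
  simp [lie_2000, lie_1100, lie_0020, apply_four_zero₀, apply_four_zero₁,
    apply_four_zero₃, apply_four_eq, apply_four_smul₀, apply_four_smul₂, apply_four_smul₃,
    apply_four_add₃, apply_four_neg₂, apply_four_neg₃, ← neg_smul]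
    at r1 r2 r3 r3' r4 r5 r6
  simp only [sliceCoeff]
  refine ⟨by simp [apply_four_eq], by simp [apply_four_eq], s1, ?_, ?_, ?_, ?_⟩ <;> linarith

/-- A relative `4`-cochain is determined by three coefficients. -/
theorem relCochain_four_eq_zero {σ : Cochain Ham0 4} (hσ : σ ∈ relCochain 4 4)
    (h1 : sliceCoeff σ 0 3 0 = 0) (h2 : sliceCoeff σ 1 2 0 = 0) (h3 : sliceCoeff σ 1 0 2 = 0) :
    σ = 0 := by
  obtain ⟨r1, r2, r3, r4, r5, r6, r7⟩ := sliceCoeff_relations hσ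
  refine relCochain_four_eq_zero_of_slice hσ fun i j k hijk => ?_
  have hi : i ≤ 3 := by omega
  have hj : j ≤ 3 := by omega
  obtain rfl : k = 3 - i - j := by omega
  interval_cases i <;> interval_cases j <;> first | omega | simp_all

end Four

/-! ### Cochains defined by graphs -/

section Graph

variable {m : ℕ}

/-- The polynomial functions on `(ℝ⁴)^m`: the variable `(i, a)` is the coordinate `a` of the `i`-th
point. -/
abbrev MultiPoly (m : ℕ) : Type := MvPolynomial (Fin m × Fin 4) ℝ

/-- A polynomial on `ℝ⁴`, evaluated at the `i`-th point. -/
noncomputable def slot (i : Fin m) : Poly →ₐ[ℝ] MultiPoly m := rename fun a => (i, a)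

/-- The bidifferential operator given by the Poisson bivector in the `i`-th and `j`-th point. -/
noncomputable def edgeOp (i j : Fin m) : MultiPoly m →ₗ[ℝ] MultiPoly m :=
  (pderiv (i, 0)).toLinearMap ∘ₗ (pderiv (j, 3)).toLinearMap
    + (pderiv (i, 1)).toLinearMap ∘ₗ (pderiv (j, 2)).toLinearMap
    - (pderiv (i, 2)).toLinearMap ∘ₗ (pderiv (j, 1)).toLinearMap
    - (pderiv (i, 3)).toLinearMap ∘ₗ (pderiv (j, 0)).toLinearMap

theorem edgeOp_apply (i j : Fin m) (F : MultiPoly m) :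
    edgeOp i j F = pderiv (i, 0) (pderiv (j, 3) F) + pderiv (i, 1) (pderiv (j, 2) F)
      - pderiv (i, 2) (pderiv (j, 1) F) - pderiv (i, 3) (pderiv (j, 0) F) := rfl

/-- The composition of the operators of all edges of a multigraph, evaluated at the origin. -/
noncomputable def contraction : List (Fin m × Fin m) → MultiPoly m →ₗ[ℝ] ℝ
  | [] => lcoeff ℝ 0
  | e :: l => contraction l ∘ₗ edgeOp e.1 e.2

theorem contraction_nil (F : MultiPoly m) : contraction [] F = constantCoeff F := rfl

theorem contraction_cons (e : Fin m × Fin m) (l : List (Fin m × Fin m)) (F : MultiPoly m) :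
    contraction (e :: l) F = contraction l (edgeOp e.1 e.2 F) := rfl

theorem pderiv_comm {σ : Type*} (i j : σ) (f : MvPolynomial σ ℝ) :
    pderiv i (pderiv j f) = pderiv j (pderiv i f) := by
  classical
  have h : ⁅(pderiv i : Derivation ℝ (MvPolynomial σ ℝ) (MvPolynomial σ ℝ)),
      (pderiv j : Derivation ℝ (MvPolynomial σ ℝ) (MvPolynomial σ ℝ))⁆ = 0 := by
    refine derivation_ext fun k => ?_
    rw [Derivation.commutator_apply, pderiv_X, pderiv_X]
    simp only [Pi.single_apply]
    split_ifs <;> simp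
  have := congrArg (fun D : Derivation ℝ (MvPolynomial σ ℝ) (MvPolynomial σ ℝ) => D f) h
  simpa [Derivation.commutator_apply, sub_eq_zero] using this

theorem pderiv_slot_self (i : Fin m) (a : Fin 4) (f : Poly) :
    pderiv (i, a) (slot i f) = slot i (pderiv a f) :=
  pderiv_rename (f := fun a : Fin 4 => (i, a)) (fun _ _ h => (Prod.mk.inj h).2) a f

theorem pderiv_slot_of_ne {i j : Fin m} (h : j ≠ i) (a : Fin 4) (f : Poly) :
    pderiv (i, a) (slot j f) = 0 := by
  refine pderiv_eq_zero_of_notMem_vars fun hv => ?_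
  obtain ⟨b, _, hb⟩ := Finset.mem_image.1 (vars_rename (fun a : Fin 4 => (j, a)) f hv)
  exact h (Prod.mk.inj hb).1

theorem prod_slot_update (f : Fin m → Poly) (i : Fin m) (y : Poly) :
    ∏ k, slot k (Function.update f i y k) = slot i y * ∏ k ∈ {i}ᶜ, slot k (f k) := by
  rw [Fintype.prod_eq_mul_prod_compl i, Function.update_self]
  congr 1
  refine Finset.prod_congr rfl fun k hk => ?_
  rw [Function.update_of_ne (by simpa using hk)]

/-- A derivative in a coordinate of the `i`-th point acts on the `i`-th factor only. -/
theorem pderiv_prod_slot (f : Fin m → Poly) (i : Fin m) (a : Fin 4) :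
    pderiv (i, a) (∏ k, slot k (f k)) =
      ∏ k, slot k (Function.update f i (pderiv a (f i)) k) := by
  have h0 : pderiv (i, a) (∏ k ∈ {i}ᶜ, slot k (f k)) = 0 := by
    refine Finset.prod_induction _ (fun F => pderiv (i, a) F = 0) (fun F G hF hG => ?_) ?_
      fun k hk => pderiv_slot_of_ne (by simpa using hk) a _
    · simp [Derivation.leibniz, hF, hG]
    · simp
  rw [prod_slot_update, Fintype.prod_eq_mul_prod_compl i, Derivation.leibniz, h0,
    pderiv_slot_self, smul_zero, zero_add, smul_eq_mul, mul_comm]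

/-- The Hamiltonian vector field of `q`, acting diagonally on the functions of `m` points. -/
noncomputable def hamOp (q : Poly) : Derivation ℝ (MultiPoly m) (MultiPoly m) :=
  ∑ i, (slot i (pderiv 0 q) • pderiv (i, 3) + slot i (pderiv 1 q) • pderiv (i, 2)
    - slot i (pderiv 2 q) • pderiv (i, 1) - slot i (pderiv 3 q) • pderiv (i, 0))

theorem hamOp_apply (q : Poly) (F : MultiPoly m) :
    hamOp q F = ∑ i, (slot i (pderiv 0 q) * pderiv (i, 3) F + slot i (pderiv 1 q) * pderiv (i, 2) F
      - slot i (pderiv 2 q) * pderiv (i, 1) F - slot i (pderiv 3 q) * pderiv (i, 0) F) := by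
  rw [hamOp, ← Derivation.coeFnAddMonoidHom_apply, map_sum, Finset.sum_apply]
  rfl

/-- On products of functions of single points the vector field of `q` acts by brackets with `q`. -/
theorem hamOp_prod_slot (q : Poly) (f : Fin m → Poly) :
    hamOp q (∏ k, slot k (f k)) = ∑ i, ∏ k, slot k (Function.update f i (poisson q (f i)) k) := by
  rw [hamOp_apply]
  refine Finset.sum_congr rfl fun i _ => ?_
  simp only [pderiv_prod_slot, prod_slot_update, poisson, map_add, map_sub, map_mul]
  ring

/-- The commutator of a partial derivative with the vector field of a quadratic form `q` has constant
coefficients, given by the Hessian `h` of `q`. -/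
theorem pderiv_hamOp {q : Poly} {h : Fin 4 → Fin 4 → ℝ}
    (hq : ∀ a b, pderiv b (pderiv a q) = C (h a b)) (j : Fin m) (b : Fin 4) (F : MultiPoly m) :
    pderiv (j, b) (hamOp q F) = hamOp q (pderiv (j, b) F) +
      (h 0 b • pderiv (j, 3) F + h 1 b • pderiv (j, 2) F - h 2 b • pderiv (j, 1) F
        - h 3 b • pderiv (j, 0) F) := by
  have h1 : ∀ i a, pderiv (j, b) (slot i (pderiv a q)) = if i = j then C (h a b) else 0 := by
    intro i a
    split_ifs with hij
    · subst hij
      rw [pderiv_slot_self, hq, slot, rename_C]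
    · rw [pderiv_slot_of_ne hij]
  simp only [hamOp_apply, map_sum, map_add, map_sub, Derivation.leibniz, h1, smul_eq_mul,
    pderiv_comm (j, b)]
  rw [← sub_eq_iff_eq_add', ← Finset.sum_sub_distrib, Finset.sum_eq_single j]
  · simp only [if_true, smul_eq_C_mul]
    ring
  · intro i _ hij
    simp only [if_neg hij]
    ring
  · simp

/-- The Poisson bivector is preserved by linear Hamiltonian vector fields. -/
theorem edgeOp_hamOp {q : Poly} (hq : q.IsHomogeneous 2) (i j : Fin m) (F : MultiPoly m) :
    edgeOp i j (hamOp q F) = hamOp q (edgeOp i j F) := by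
  obtain ⟨h, hh⟩ : ∃ h : Fin 4 → Fin 4 → ℝ, ∀ a b, pderiv b (pderiv a q) = C (h a b) :=
    ⟨fun a b => constantCoeff (pderiv b (pderiv a q)), fun a b =>
      eq_C_of_isHomogeneous_zero (hq.pderiv (i := a)).pderiv⟩
  have hs : ∀ a b, h a b = h b a := fun a b => by
    have := pderiv_comm' b a q
    rw [hh, hh] at this
    exact C_injective _ _ this
  simp only [edgeOp_apply, pderiv_hamOp hh, map_add, map_sub, Derivation.map_smul, hs 1 0, hs 2 0,
    hs 3 0, hs 2 1, hs 3 1, hs 3 2]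
  module

/-- The vector field of a quadratic form can be moved past all edges, and it vanishes at the
origin. -/
theorem contraction_hamOp {q : Ham0} (hq : (q : Poly).IsHomogeneous 2)
    (l : List (Fin m × Fin m)) (F : MultiPoly m) : contraction l (hamOp (q : Poly) F) = 0 := by
  induction l generalizing F with
  | nil =>
    have h : ∀ i a, constantCoeff (slot (m := m) i (pderiv a (q : Poly))) = 0 := fun i a => by
      rw [slot, constantCoeff_rename, q.2.2 a]
    simp [contraction_nil, hamOp_apply, h]
  | cons e l ih => rw [contraction_cons, edgeOp_hamOp hq, ih]

/-- The multilinear form that a multigraph with vertices `Fin m` defines: it applies the Poisson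
bivector along every edge to the product of the arguments and evaluates at the origin. -/
noncomputable def graphForm (l : List (Fin m × Fin m)) :
    MultilinearMap ℝ (fun _ : Fin m => Ham0) ℝ :=
  (contraction l).compMultilinearMap
    ((MultilinearMap.mkPiAlgebra ℝ (Fin m) (MultiPoly m)).compLinearMap
      fun i => (slot i).toLinearMap ∘ₗ Ham0.subtype)

theorem graphForm_apply (l : List (Fin m × Fin m)) (v : Fin m → Ham0) :
    graphForm l v = contraction l (∏ k, slot k (v k : Poly)) := rfl

theorem graphForm_invariant {q : Ham0} (hq : (q : Poly).IsHomogeneous 2)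
    (l : List (Fin m × Fin m)) (v : Fin m → Ham0) :
    ∑ j, graphForm l (Function.update v j ⁅q, v j⁆) = 0 := by
  rw [← contraction_hamOp hq l (∏ k, slot k (v k : Poly)), hamOp_prod_slot, map_sum]
  refine Finset.sum_congr rfl fun j _ => ?_
  rw [graphForm_apply]
  congr 1
  refine Finset.prod_congr rfl fun k _ => ?_
  by_cases h : k = j
  · subst h; simp [coe_bracket]
  · simp [h]

/-- The number of edge ends at a vertex of a multigraph. -/
def valence (l : List (Fin m × Fin m)) (k : Fin m) : ℕ :=
  (l.map fun e => (if e.1 = k then 1 else 0) + if e.2 = k then 1 else 0).sum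

/-- The weight that counts the degree in the coordinates of the `k`-th point. -/
def slotWeight (k : Fin m) (p : Fin m × Fin 4) : ℤ := if p.1 = k then 1 else 0

theorem isWeightedHomogeneous_slot_self (k : Fin m) {f : Poly} {n : ℕ} (hf : f.IsHomogeneous n) :
    IsWeightedHomogeneous (slotWeight k) (slot k f) (n : ℤ) := by
  intro d hd
  obtain ⟨u, rfl, hu⟩ := coeff_rename_ne_zero _ _ _ hd
  rw [← hf hu]
  simp only [Finsupp.weight_apply, slotWeight]
  rw [Finsupp.sum_mapDomain_index (by simp) (by intros; rw [add_smul])]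
  simp [Finsupp.sum]

theorem isWeightedHomogeneous_slot_of_ne {i k : Fin m} (h : i ≠ k) (f : Poly) :
    IsWeightedHomogeneous (slotWeight k) (slot i f) (0 : ℤ) := by
  intro d hd
  obtain ⟨u, rfl, hu⟩ := coeff_rename_ne_zero _ _ _ hd
  simp only [Finsupp.weight_apply, slotWeight]
  rw [Finsupp.sum_mapDomain_index (by simp) (by intros; rw [add_smul])]
  simp [Finsupp.sum, h]

theorem isWeightedHomogeneous_edgeOp (i j k : Fin m) {F : MultiPoly m} {n : ℤ}
    (hF : IsWeightedHomogeneous (slotWeight k) F n) :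
    IsWeightedHomogeneous (slotWeight k) (edgeOp i j F)
      (n - ((if i = k then 1 else 0) + if j = k then 1 else 0)) := by
  have h : ∀ a b, IsWeightedHomogeneous (slotWeight k) (pderiv (i, a) (pderiv (j, b) F))
      (n - ((if i = k then 1 else 0) + if j = k then 1 else 0)) := fun a b => by
    refine (hF.pderiv (n' := n - if j = k then 1 else 0) ?_).pderiv ?_
    · simp [slotWeight]
    · simp only [slotWeight]; ring
  have hsub : ∀ {G H : MultiPoly m} {r : ℤ}, IsWeightedHomogeneous (slotWeight k) G r →
      IsWeightedHomogeneous (slotWeight k) H r → IsWeightedHomogeneous (slotWeight k) (G - H) r :=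
    fun hG hH => (weightedHomogeneousSubmodule ℝ (slotWeight k) _).sub_mem hG hH
  exact hsub (hsub ((h 0 3).add (h 1 2)) (h 2 1)) (h 3 0)

/-- Every edge end at `k` lowers the degree at the `k`-th point by one, and evaluation at the origin
keeps the part of degree zero. -/
theorem contraction_eq_zero (l : List (Fin m × Fin m)) (k : Fin m) {F : MultiPoly m} {n : ℤ}
    (hF : IsWeightedHomogeneous (slotWeight k) F n) (hn : n ≠ valence l k) :
    contraction l F = 0 := by
  induction l generalizing F n with
  | nil =>
    rw [contraction_nil, constantCoeff_eq]
    exact hF.coeff_eq_zero 0 (by simpa [valence] using hn.symm)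
  | cons e l ih =>
    rw [contraction_cons]
    refine ih (isWeightedHomogeneous_edgeOp e.1 e.2 k hF) fun h => hn ?_
    rw [valence, List.map_cons, List.sum_cons]
    rw [valence] at h
    push_cast at h ⊢
    linarith

/-- The form of a multigraph vanishes unless the degree of each argument is the valence of its
vertex. -/
theorem graphForm_eq_zero (l : List (Fin m × Fin m)) (v : Fin m → Ham0) (k : Fin m) {n : ℕ}
    (hv : (v k : Poly).IsHomogeneous n) (hn : n ≠ valence l k) : graphForm l v = 0 := by
  rw [graphForm_apply, Fintype.prod_eq_mul_prod_compl k]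
  refine contraction_eq_zero l k (n := n) ?_ (by exact_mod_cast hn)
  have h := IsWeightedHomogeneous.prod (w := slotWeight k) ({k}ᶜ : Finset (Fin m))
    (fun i => slot i (v i : Poly)) (fun _ => (0 : ℤ))
    fun i hi => isWeightedHomogeneous_slot_of_ne (by simpa using hi) _
  simpa using (isWeightedHomogeneous_slot_self k hv).mul h

/-- The alternating form of a multigraph. -/
noncomputable def graphCochain (l : List (Fin m × Fin m)) : Cochain Ham0 m :=
  MultilinearMap.alternatization (graphForm l)

theorem graphCochain_apply (l : List (Fin m × Fin m)) (v : Fin m → Ham0) :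
    graphCochain l v = ∑ π : Equiv.Perm (Fin m),
      (Equiv.Perm.sign π : ℤ) * graphForm l (fun i => v (π i)) := by
  rw [graphCochain, MultilinearMap.alternatization_apply]
  refine Finset.sum_congr rfl fun π _ => ?_
  rw [Units.smul_def, zsmul_eq_mul]
  rfl

/-- The alternating form of a multigraph whose vertices all have valence at least `3` is a relative
cochain. -/
theorem graphCochain_mem (l : List (Fin (m + 1) × Fin (m + 1))) (w : ℤ)
    (h3 : ∀ k, 3 ≤ valence l k) (hw : ∑ k, ((valence l k : ℤ) - 2) = w) :
    graphCochain l ∈ relCochain (m + 1) w := by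
  refine mem_relCochain_succ.2 ⟨fun ℓ f hf hℓ => ?_, fun ξ => ⟨?_, ?_⟩⟩
  · rw [graphCochain_apply]
    refine Finset.sum_eq_zero fun π _ => ?_
    -- Otherwise the degrees would be the valences up to order, with total weight `w`.
    have : ∃ k, ℓ (π k) ≠ valence l k := by
      by_contra hh
      push Not at hh
      apply hℓ
      rw [← hw, ← Equiv.sum_comp π]
      simp [hh]
    obtain ⟨k, hk⟩ := this
    rw [graphForm_eq_zero l (fun i => f (π i)) k (hf (π k)) hk, mul_zero]
  · ext v
    rw [AlternatingMap.curryLeft_apply_apply, graphCochain_apply]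
    refine Finset.sum_eq_zero fun π _ => ?_
    rw [graphForm_eq_zero l _ (π.symm 0) (n := 2) ?_ ?_, mul_zero]
    · simpa using isHomogeneous_momentum ξ
    · have := h3 (π.symm 0)
      omega
  · ext v
    rw [derivForm_apply]
    simp only [graphCochain_apply]
    rw [Finset.sum_comm, AlternatingMap.zero_apply]
    refine Finset.sum_eq_zero fun π _ => ?_
    rw [← Finset.mul_sum, ← Equiv.sum_comp π]
    have := graphForm_invariant (isHomogeneous_momentum ξ) l (fun i => v (π i))
    rw [← mul_zero ((Equiv.Perm.sign π : ℤ) : ℝ), ← this]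
    congr 1
    refine Finset.sum_congr rfl fun j _ => ?_
    congr 1
    funext i
    by_cases h : i = j
    · subst h; simp
    · rw [Function.update_of_ne h, Function.update_of_ne (π.injective.ne h)]

end Graph

/-! ### Evaluation of graph cochains on monomials -/

section Count

variable {m : ℕ}

/-- Lower the exponent of the coordinate `a` of the `i`-th point by one. -/
def lower (α : Fin m → Fin 4 → ℕ) (i : Fin m) (a : Fin 4) : Fin m → Fin 4 → ℕ :=
  Function.update α i (Function.update (α i) a (α i a - 1))

/-- The value of `c` after differentiation in the coordinate `a` of the `i`-th and the coordinate
`b` of the `j`-th point; it is zero where an exponent is zero already. -/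
def lowerTwo (c : (Fin m → Fin 4 → ℕ) → ℤ) (α : Fin m → Fin 4 → ℕ) (i j : Fin m)
    (a b : Fin 4) : ℤ :=
  if α j b = 0 then 0
  else if lower α j b i a = 0 then 0 else c (lower (lower α j b) i a)

/-- The value of the form of a multigraph on the basis elements with exponents `α`, in a form that
can be computed. -/
def graphCount : List (Fin m × Fin m) → (Fin m → Fin 4 → ℕ) → ℤ
  | [], α => if ∀ i a, α i a = 0 then 1 else 0
  | e :: l, α => lowerTwo (graphCount l) α e.1 e.2 0 3 + lowerTwo (graphCount l) α e.1 e.2 1 2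
      - lowerTwo (graphCount l) α e.1 e.2 2 1 - lowerTwo (graphCount l) α e.1 e.2 3 0

/-- The value of the alternating form of a multigraph on the basis elements with exponents `α`. -/
def altCount (l : List (Fin m × Fin m)) (α : Fin m → Fin 4 → ℕ) : ℤ :=
  ∑ π : Equiv.Perm (Fin m), (Equiv.Perm.sign π : ℤ) * graphCount l (fun i => α (π i))

/-- The product of the basis elements with exponents `α i`, each evaluated at the `i`-th point. -/
noncomputable def multiMono (α : Fin m → Fin 4 → ℕ) : MultiPoly m :=
  ∏ k, slot k (basisPoly (α k 0) (α k 1) (α k 2) (α k 3))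

theorem pderiv_multiMono (α : Fin m → Fin 4 → ℕ) (i : Fin m) (a : Fin 4) :
    pderiv (i, a) (multiMono α) = if α i a = 0 then 0 else multiMono (lower α i a) := by
  have h : pderiv a (basisPoly (α i 0) (α i 1) (α i 2) (α i 3)) = if α i a = 0 then 0 else
      basisPoly (lower α i a i 0) (lower α i a i 1) (lower α i a i 2) (lower α i a i 3) := by
    fin_cases a <;> simp [pderiv_basisPoly_zero, pderiv_basisPoly_one, pderiv_basisPoly_two,
      pderiv_basisPoly_three, lower]
  rw [multiMono, pderiv_prod_slot, h]
  split_ifs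
  · rw [prod_slot_update, map_zero, zero_mul]
  · refine Finset.prod_congr rfl fun k _ => ?_
    by_cases hk : k = i
    · subst hk; simp
    · simp [lower, hk]

theorem contraction_multiMono (l : List (Fin m × Fin m)) (α : Fin m → Fin 4 → ℕ) :
    contraction l (multiMono α) = graphCount l α := by
  induction l generalizing α with
  | nil =>
    rw [contraction_nil, multiMono, map_prod, graphCount]
    simp only [slot, constantCoeff_rename]
    have h : ∀ k, constantCoeff (basisPoly (α k 0) (α k 1) (α k 2) (α k 3)) =
        if ∀ a, α k a = 0 then 1 else 0 := by
      intro k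
      rw [basisPoly, constantCoeff_monomial]
      have : Finsupp.equivFunOnFinite.symm ![α k 0, α k 1, α k 2, α k 3] = 0 ↔
          ∀ a, α k a = 0 := by
        rw [DFunLike.ext_iff]
        simp [Fin.forall_fin_succ]
      simp only [this]
      split_ifs with h0
      · simp [h0]
      · rfl
    simp only [h]
    rw [Finset.prod_ite_zero]
    simp
  | cons e l ih =>
    have h : ∀ a b, contraction l (pderiv (e.1, a) (pderiv (e.2, b) (multiMono α))) =
        lowerTwo (graphCount l) α e.1 e.2 a b := by
      intro a b
      rw [pderiv_multiMono, lowerTwo]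
      split_ifs with h1 h2
      · simp
      · rw [pderiv_multiMono, if_pos h2]; simp
      · rw [pderiv_multiMono, if_neg h2, ih]
    rw [contraction_cons, edgeOp_apply, map_sub, map_sub, map_add, h, h, h, h, graphCount]
    push_cast
    rfl

/-- Derivatives of the normalised monomials are normalised monomials, so that the values of the form
of a multigraph are integers obtained by lowering exponents along the edges. -/
theorem graphCochain_mono (l : List (Fin m × Fin m)) (α : Fin m → Fin 4 → ℕ)
    (hα : ∀ i, 2 ≤ α i 0 + α i 1 + α i 2 + α i 3) :
    graphCochain l (fun i => mono (α i 0) (α i 1) (α i 2) (α i 3)) = altCount l α := by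
  rw [graphCochain_apply, altCount]
  push_cast
  refine Finset.sum_congr rfl fun π _ => ?_
  rw [graphForm_apply, ← contraction_multiMono, multiMono]
  simp only [coe_mono (hα _)]

theorem graphCochain_mono_three (l : List (Fin 3 × Fin 3)) (a₁ b₁ c₁ e₁ a₂ b₂ c₂ e₂ a₃ b₃ c₃ e₃ : ℕ)
    (h₁ : 2 ≤ a₁ + b₁ + c₁ + e₁ := by norm_num) (h₂ : 2 ≤ a₂ + b₂ + c₂ + e₂ := by norm_num)
    (h₃ : 2 ≤ a₃ + b₃ + c₃ + e₃ := by norm_num) :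
    graphCochain l ![mono a₁ b₁ c₁ e₁, mono a₂ b₂ c₂ e₂, mono a₃ b₃ c₃ e₃] =
      altCount l ![![a₁, b₁, c₁, e₁], ![a₂, b₂, c₂, e₂], ![a₃, b₃, c₃, e₃]] := by
  rw [← graphCochain_mono]
  · congr 1
    funext i
    fin_cases i <;> rfl
  · intro i
    fin_cases i <;> assumption

theorem graphCochain_mono_four (l : List (Fin 4 × Fin 4))
    (a₁ b₁ c₁ e₁ a₂ b₂ c₂ e₂ a₃ b₃ c₃ e₃ a₄ b₄ c₄ e₄ : ℕ)
    (h₁ : 2 ≤ a₁ + b₁ + c₁ + e₁ := by norm_num) (h₂ : 2 ≤ a₂ + b₂ + c₂ + e₂ := by norm_num)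
    (h₃ : 2 ≤ a₃ + b₃ + c₃ + e₃ := by norm_num) (h₄ : 2 ≤ a₄ + b₄ + c₄ + e₄ := by norm_num) :
    graphCochain l ![mono a₁ b₁ c₁ e₁, mono a₂ b₂ c₂ e₂, mono a₃ b₃ c₃ e₃, mono a₄ b₄ c₄ e₄] =
      altCount l ![![a₁, b₁, c₁, e₁], ![a₂, b₂, c₂, e₂], ![a₃, b₃, c₃, e₃],
        ![a₄, b₄, c₄, e₄]] := by
  rw [← graphCochain_mono]
  · congr 1
    funext i
    fin_cases i <;> rfl
  · intro i
    fin_cases i <;> assumption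

end Count

/-! ### The coboundary of relative cochains -/

section Coboundary

variable {m : ℕ} {w : ℤ}

theorem eq_zero_of_isHomogeneous_lt {f : Ham0} {n : ℕ} (hf : (f : Poly).IsHomogeneous n)
    (hn : n < 2) : f = 0 := by
  ext1
  interval_cases n
  · rw [eq_C_of_isHomogeneous_zero hf, f.2.1, map_zero]
    rfl
  · have h : ∀ i, pderiv i (f : Poly) = 0 := fun i => by
      rw [eq_C_of_isHomogeneous_zero (hf.pderiv (i := i)), f.2.2, map_zero]
    have := hf.sum_X_mul_pderiv
    simpa [h] using this.symm

theorem isHomogeneous_lie {f g : Ham0} {n k : ℕ} (hf : (f : Poly).IsHomogeneous n)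
    (hg : (g : Poly).IsHomogeneous k) (hn : 2 ≤ n) (hk : 2 ≤ k) :
    ((⁅f, g⁆ : Ham0) : Poly).IsHomogeneous (n + k - 2) := by
  have h : ∀ i j, (pderiv i (f : Poly) * pderiv j (g : Poly)).IsHomogeneous (n + k - 2) := by
    intro i j
    have := (hf.pderiv (i := i)).mul (hg.pderiv (i := j))
    rwa [show n - 1 + (k - 1) = n + k - 2 by omega] at this
  rw [coe_bracket, poisson]
  exact (((h 0 3).add (h 1 2)).sub (h 2 1)).sub (h 3 0)

theorem d_mem_weightCochain {σ : Cochain Ham0 m} (hσ : σ ∈ weightCochain m w) :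
    d σ ∈ weightCochain (m + 1) w := by
  intro ℓ f hf hℓ
  rw [d_apply]
  refine Finset.sum_eq_zero fun i _ => Finset.sum_eq_zero fun j hj => ?_
  have hij : j ≠ i := ne_of_gt (by simpa using hj)
  obtain ⟨k, rfl⟩ := Fin.exists_succAbove_eq hij
  rw [Fin.removeNth_update_succAbove]
  by_cases h0 : ⁅f i, f (i.succAbove k)⁆ = 0
  · rw [h0, σ.map_update_zero, mul_zero]
  have hi : 2 ≤ ℓ i := by
    by_contra h
    rw [eq_zero_of_isHomogeneous_lt (hf i) (by omega), zero_lie] at h0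
    exact h0 rfl
  have hk : 2 ≤ ℓ (i.succAbove k) := by
    by_contra h
    rw [eq_zero_of_isHomogeneous_lt (hf _) (by omega : ℓ (i.succAbove k) < 2), lie_zero] at h0
    exact h0 rfl
  rw [hσ (Function.update (i.removeNth ℓ) k (ℓ i + ℓ (i.succAbove k) - 2)), mul_zero]
  · intro n
    by_cases hn : n = k
    · subst hn
      simpa using isHomogeneous_lie (hf _) (hf _) hi hk
    · simpa [hn, Fin.removeNth] using hf _
  · intro h
    apply hℓ
    rw [← h, Fin.sum_univ_succAbove _ i, ← Finset.add_sum_erase _ _ (Finset.mem_univ k),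
      ← Finset.add_sum_erase Finset.univ (fun n => ((Function.update (i.removeNth ℓ) k
        (ℓ i + ℓ (i.succAbove k) - 2) n : ℕ) : ℤ) - 2) (Finset.mem_univ k), ← add_assoc]
    congr 1
    · rw [Function.update_self]
      omega
    · refine Finset.sum_congr rfl fun n hn => ?_
      rw [Function.update_of_ne (Finset.ne_of_mem_erase hn)]
      rfl

theorem d_mem_relCochain {σ : Cochain Ham0 (m + 1)} (hσ : σ ∈ relCochain (m + 1) w) :
    d σ ∈ relCochain (m + 2) w := by
  have h := mem_relCochain_succ.1 hσ
  refine mem_relCochain_succ.2 ⟨d_mem_weightCochain h.1, fun ξ => ⟨?_, ?_⟩⟩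
  · rw [curryLeft_d, (h.2 ξ).1, (h.2 ξ).2, map_zero, neg_zero, sub_zero]
  · rw [derivForm_d, (h.2 ξ).2, map_zero]

/-- The coboundary of a `3`-form, written out. -/
theorem d_three (σ : Cochain Ham0 3) (x y z t : Ham0) :
    d σ ![x, y, z, t] = -σ ![⁅x, y⁆, z, t] - σ ![y, ⁅x, z⁆, t] - σ ![y, z, ⁅x, t⁆]
      + σ ![x, ⁅y, z⁆, t] + σ ![x, z, ⁅y, t⁆] - σ ![x, y, ⁅z, t⁆] := by
  have h01 : ∀ u, (0 : Fin 4).removeNth (Function.update ![x, y, z, t] 1 u) = ![u, z, t] :=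
    fun u => by funext k; fin_cases k <;> rfl
  have h02 : ∀ u, (0 : Fin 4).removeNth (Function.update ![x, y, z, t] 2 u) = ![y, u, t] :=
    fun u => by funext k; fin_cases k <;> rfl
  have h03 : ∀ u, (0 : Fin 4).removeNth (Function.update ![x, y, z, t] 3 u) = ![y, z, u] :=
    fun u => by funext k; fin_cases k <;> rfl
  have h12 : ∀ u, (1 : Fin 4).removeNth (Function.update ![x, y, z, t] 2 u) = ![x, u, t] :=
    fun u => by funext k; fin_cases k <;> rfl
  have h13 : ∀ u, (1 : Fin 4).removeNth (Function.update ![x, y, z, t] 3 u) = ![x, z, u] :=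
    fun u => by funext k; fin_cases k <;> rfl
  have h23 : ∀ u, (2 : Fin 4).removeNth (Function.update ![x, y, z, t] 3 u) = ![x, y, u] :=
    fun u => by funext k; fin_cases k <;> rfl
  simp [d_apply, Finset.sum_filter, Fin.sum_univ_four, h01, h02, h03, h12, h13, h23]
  ring

end Coboundary

/-! ### The relative cochains of weight four -/

section Weight

/-- The multigraph on three vertices with valences `3, 3, 4`. -/
def threeGraph : List (Fin 3 × Fin 3) := [(0, 1), (0, 2), (0, 2), (1, 2), (1, 2)]

/-- The generator of the relative `3`-cochains of weight `4`. The factor normalises its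
coefficients. -/
noncomputable def generator : Cochain Ham0 3 := (-(1 / 2) : ℝ) • graphCochain threeGraph

theorem generator_apply (a₁ b₁ c₁ e₁ a₂ b₂ c₂ e₂ a₃ b₃ c₃ e₃ : ℕ) (n : ℤ)
    (hn : altCount threeGraph ![![a₁, b₁, c₁, e₁], ![a₂, b₂, c₂, e₂], ![a₃, b₃, c₃, e₃]] = -2 * n)
    (h₁ : 2 ≤ a₁ + b₁ + c₁ + e₁ := by norm_num) (h₂ : 2 ≤ a₂ + b₂ + c₂ + e₂ := by norm_num)
    (h₃ : 2 ≤ a₃ + b₃ + c₃ + e₃ := by norm_num) :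
    generator ![mono a₁ b₁ c₁ e₁, mono a₂ b₂ c₂ e₂, mono a₃ b₃ c₃ e₃] = n := by
  rw [generator, AlternatingMap.smul_apply, graphCochain_mono_three _ _ _ _ _ _ _ _ _ _ _ _ _ h₁ h₂ h₃, hn]
  push_cast
  rw [smul_eq_mul]
  ring

theorem generator_mem : generator ∈ relCochain 3 4 :=
  Submodule.smul_mem _ _ (graphCochain_mem _ _ (by decide) (by decide))

theorem relCochain_three : relCochain 3 4 = Submodule.span ℝ {generator} := by
  have hA : generator ![mono 4 0 0 0, mono 0 0 0 3, mono 1 0 0 2] = ((1 : ℤ) : ℝ) :=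
    generator_apply 4 0 0 0 0 0 0 3 1 0 0 2 1 (by decide +kernel)
  refine le_antisymm (fun σ hσ => ?_)
    ((Submodule.span_singleton_le_iff_mem _ _).2 generator_mem)
  refine Submodule.mem_span_singleton.2 ⟨σ ![mono 4 0 0 0, mono 0 0 0 3, mono 1 0 0 2], ?_⟩
  rw [eq_comm, ← sub_eq_zero]
  refine relCochain_three_eq_zero (sub_mem hσ (Submodule.smul_mem _ _ generator_mem)) ?_
  rw [AlternatingMap.sub_apply, AlternatingMap.smul_apply, hA]
  simp

theorem d_generator_ne_zero : d generator ≠ 0 := by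
  intro h
  -- On the monomials `x₄³`, `x₂³`, `x₁ x₃²`, `x₁² x₃` each bracket is zero or a single monomial.
  have b1 : ⁅mono 0 0 0 3, mono 0 3 0 0⁆ = 0 := by
    ext1
    simp [coe_bracket, coe_mono, poisson, pderiv_basisPoly_zero, pderiv_basisPoly_one,
      pderiv_basisPoly_two, pderiv_basisPoly_three]
  have b2 : ⁅mono 0 0 0 3, mono 1 0 2 0⁆ = -mono 0 0 2 2 := by
    ext1
    simp [coe_bracket, coe_mono, poisson, pderiv_basisPoly_zero, pderiv_basisPoly_one,
      pderiv_basisPoly_two, pderiv_basisPoly_three, basisPoly_mul]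
  have b3 : ⁅mono 0 0 0 3, mono 2 0 1 0⁆ = -mono 1 0 1 2 := by
    ext1
    simp [coe_bracket, coe_mono, poisson, pderiv_basisPoly_zero, pderiv_basisPoly_one,
      pderiv_basisPoly_two, pderiv_basisPoly_three, basisPoly_mul]
  have b4 : ⁅mono 0 3 0 0, mono 1 0 2 0⁆ = mono 1 2 1 0 := by
    ext1
    simp [coe_bracket, coe_mono, poisson, pderiv_basisPoly_zero, pderiv_basisPoly_one,
      pderiv_basisPoly_two, pderiv_basisPoly_three, basisPoly_mul]
  have b5 : ⁅mono 0 3 0 0, mono 2 0 1 0⁆ = mono 2 2 0 0 := by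
    ext1
    simp [coe_bracket, coe_mono, poisson, pderiv_basisPoly_zero, pderiv_basisPoly_one,
      pderiv_basisPoly_two, pderiv_basisPoly_three, basisPoly_mul]
  have b6 : ⁅mono 1 0 2 0, mono 2 0 1 0⁆ = 0 := by
    ext1
    simp [coe_bracket, coe_mono, poisson, pderiv_basisPoly_zero, pderiv_basisPoly_one,
      pderiv_basisPoly_two, pderiv_basisPoly_three]
  have e := congrArg
    (fun ρ => ρ ![mono 0 0 0 3, mono 0 3 0 0, mono 1 0 2 0, mono 2 0 1 0]) h
  have n1 : ∀ x y z : Ham0, generator ![x, -y, z] = -generator ![x, y, z] := fun x y z => by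
    have := generator.map_update_neg ![x, y, z] 1 y
    have hu : ∀ u, Function.update ![x, y, z] 1 u = ![x, u, z] := fun u => by
      funext k; fin_cases k <;> rfl
    rwa [hu, hu] at this
  have n2 : ∀ x y z : Ham0, generator ![x, y, -z] = -generator ![x, y, z] := fun x y z => by
    have := generator.map_update_neg ![x, y, z] 2 z
    have hu : ∀ u, Function.update ![x, y, z] 2 u = ![x, y, u] := fun u => by
      funext k; fin_cases k <;> rfl
    rwa [hu, hu] at this
  have z0 : ∀ y z : Ham0, generator ![0, y, z] = 0 := fun y z => generator.map_coord_zero 0 rfl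
  have z2 : ∀ x y : Ham0, generator ![x, y, 0] = 0 := fun x y => generator.map_coord_zero 2 rfl
  simp only [d_three, b1, b2, b3, b4, b5, b6, n1, n2, z0, z2, AlternatingMap.zero_apply] at e
  rw [generator_apply 0 3 0 0 0 0 2 2 2 0 1 0 (1) (by decide +kernel)] at e
  rw [generator_apply 0 3 0 0 1 0 2 0 1 0 1 2 (0) (by decide +kernel)] at e
  rw [generator_apply 0 0 0 3 1 2 1 0 2 0 1 0 (0) (by decide +kernel)] at e
  rw [generator_apply 0 0 0 3 1 0 2 0 2 2 0 0 (1) (by decide +kernel)] at e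
  norm_num at e

/-- There are no constants of weight `4`. -/
theorem relCochain_zero : relCochain 0 4 = ⊥ := by
  rw [eq_bot_iff]
  intro σ hσ
  rw [Submodule.mem_bot]
  ext v
  exact hσ.1 (fun i => i.elim0) v (fun i => i.elim0) (by simp)

/-- The three perfect matchings of four vertices. The loopless multigraphs on four vertices with all
valences equal to `3` are the sums of three of them. -/
def matching : Fin 3 → List (Fin 4 × Fin 4) :=
  ![[(0, 1), (2, 3)], [(0, 2), (1, 3)], [(0, 3), (1, 2)]]

/-- The alternating form of a sum of three matchings. -/
noncomputable def fourCochain (i j k : Fin 3) : Cochain Ham0 4 :=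
  graphCochain (matching i ++ matching j ++ matching k)

theorem fourCochain_mem (i j k : Fin 3) : fourCochain i j k ∈ relCochain 4 4 := by
  have h : ∀ i j k, (∀ n, valence (matching i ++ matching j ++ matching k) n = 3) := by decide
  refine graphCochain_mem _ _ (fun n => (h i j k n).ge) ?_
  simp only [h]
  decide

theorem sliceCoeff_fourCochain (p q r : Fin 3) (i j k : ℕ) (h : i + j + k = 3) :
    sliceCoeff (fourCochain p q r) i j k = altCount (matching p ++ matching q ++ matching r)
      ![![3, 0, 0, 0], ![0, 0, 0, 3], ![i, 0, j, k], ![k, j, 0, i]] :=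
  graphCochain_mono_four _ 3 0 0 0 0 0 0 3 i 0 j k k j 0 i (by norm_num) (by norm_num) (by omega)
    (by omega)

/-- Three coefficients that determine a relative `4`-cochain. -/
noncomputable def sliceMap : relCochain 4 4 →ₗ[ℝ] Fin 3 → ℝ where
  toFun σ := ![sliceCoeff σ 0 3 0, sliceCoeff σ 1 2 0, sliceCoeff σ 1 0 2]
  map_add' σ τ := by ext i; fin_cases i <;> rfl
  map_smul' c σ := by ext i; fin_cases i <;> rfl

theorem sliceMap_bijective : Function.Bijective sliceMap := by
  constructor
  · intro σ τ h
    have h' : ∀ i, sliceMap σ i - sliceMap τ i = 0 := fun i => by rw [h, sub_self]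
    exact Subtype.ext (sub_eq_zero.1 (relCochain_four_eq_zero (sub_mem σ.2 τ.2)
      (h' 0) (h' 1) (h' 2)))
  · intro x
    have v (p q r : Fin 3) : sliceMap ⟨_, fourCochain_mem p q r⟩ =
        ![sliceCoeff (fourCochain p q r) 0 3 0, sliceCoeff (fourCochain p q r) 1 2 0,
          sliceCoeff (fourCochain p q r) 1 0 2] := rfl
    have v1 : sliceMap ⟨_, fourCochain_mem 0 0 0⟩ = ![-8, 24, 24] := by
      rw [v, sliceCoeff_fourCochain _ _ _ _ _ _ rfl, sliceCoeff_fourCochain _ _ _ _ _ _ rfl,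
        sliceCoeff_fourCochain _ _ _ _ _ _ rfl,
        show altCount _ _ = -8 by decide +kernel, show altCount _ _ = 24 by decide +kernel,
        show altCount _ ![_, _, ![1, 0, 0, 2], _] = 24 by decide +kernel]
      norm_num
    have v2 : sliceMap ⟨_, fourCochain_mem 0 0 1⟩ = ![0, 4, 12] := by
      rw [v, sliceCoeff_fourCochain _ _ _ _ _ _ rfl, sliceCoeff_fourCochain _ _ _ _ _ _ rfl,
        sliceCoeff_fourCochain _ _ _ _ _ _ rfl,
        show altCount _ _ = 0 by decide +kernel, show altCount _ _ = 4 by decide +kernel,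
        show altCount _ _ = 12 by decide +kernel]
      norm_num
    have v3 : sliceMap ⟨_, fourCochain_mem 0 1 2⟩ = ![0, 0, -24] := by
      rw [v, sliceCoeff_fourCochain _ _ _ _ _ _ rfl, sliceCoeff_fourCochain _ _ _ _ _ _ rfl,
        sliceCoeff_fourCochain _ _ _ _ _ _ rfl,
        show altCount _ ![_, _, ![0, 0, 3, 0], _] = 0 by decide +kernel,
        show altCount _ ![_, _, ![1, 0, 2, 0], _] = 0 by decide +kernel,
        show altCount _ _ = -24 by decide +kernel]
      norm_num
    -- The matrix of the three values is triangular, and the coefficients come from inverting it.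
    refine ⟨(-(x 0 / 8)) • ⟨_, fourCochain_mem 0 0 0⟩ +
      ((x 1 + 3 * x 0) / 4) • ⟨_, fourCochain_mem 0 0 1⟩ +
      ((12 * ((x 1 + 3 * x 0) / 4) - 3 * x 0 - x 2) / 24) • ⟨_, fourCochain_mem 0 1 2⟩, ?_⟩
    rw [map_add, map_add, map_smul, map_smul, map_smul, v1, v2, v3]
    ext i
    fin_cases i <;> simp <;> ring

theorem rank_relCochain_four : Module.rank ℝ (relCochain 4 4) = 3 := by
  rw [(LinearEquiv.ofBijective sliceMap sliceMap_bijective).rank_eq, rank_fin_fun]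
  norm_num

/-! ### Cohomology -/

theorem rank_relCohomology_eq_zero {m : ℕ} {w : ℤ} (h : relCocycle m w = ⊥) :
    Module.rank ℝ (RelCohomology m w) = 0 := by
  have : Subsingleton (relCocycle m w) := by rw [h]; infer_instance
  exact rank_subsingleton' _ _

theorem relCocycle_eq_bot {m : ℕ} {w : ℤ} (h : relCochain m w = ⊥) : relCocycle m w = ⊥ := by
  rw [relCocycle, h, bot_inf_eq]

theorem relCocycle_three : relCocycle 3 4 = ⊥ := by
  rw [eq_bot_iff, relCocycle, relCochain_three]
  rintro σ ⟨h1, h2⟩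
  obtain ⟨r, rfl⟩ := Submodule.mem_span_singleton.1 h1
  have h2 : d (r • generator) = 0 := h2
  rw [map_smul, smul_eq_zero] at h2
  rw [h2.resolve_right d_generator_ne_zero, zero_smul]
  exact zero_mem _

theorem relCocycle_four : relCocycle 4 4 = relCochain 4 4 := by
  refine inf_eq_left.2 fun σ hσ => ?_
  have h := d_mem_relCochain hσ
  rw [relCochain_eq_bot (by norm_num)] at h
  exact h

theorem rank_subquotient {V : Type*} [AddCommGroup V] [Module ℝ V] {Z B : Submodule ℝ V}
    (hle : B ≤ Z) {k n : ℕ} (hZ : Module.rank ℝ Z = (n + k : ℕ)) (hB : Module.rank ℝ B = n) :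
    Module.rank ℝ (Subquotient Z B) = k := by
  have h := Submodule.rank_quotient_add_rank (B.submoduleOf Z)
  rw [(Submodule.submoduleOfEquivOfLe hle).rank_eq, hZ, hB, Nat.cast_add, add_comm] at h
  exact Cardinal.eq_of_add_eq_add_left h (Cardinal.natCast_lt_aleph0)

theorem rank_span_singleton {V : Type} [AddCommGroup V] [Module ℝ V] {x : V} (hx : x ≠ 0) :
    Module.rank ℝ (Submodule.span ℝ {x}) = 1 := by
  rw [← (LinearEquiv.toSpanNonzeroSingleton ℝ V x hx).rank_eq, Module.rank_self]

theorem rank_relCohomology_four : Module.rank ℝ (RelCohomology 4 4) = 2 := by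
  have hB : relCoboundary 4 4 = Submodule.span ℝ {d generator} := by
    rw [relCoboundary, relCochain_three, Submodule.map_span, Set.image_singleton]
  have hle : relCoboundary 4 4 ≤ relCocycle 4 4 := by
    rw [hB, relCocycle_four, Submodule.span_singleton_le_iff_mem]
    exact d_mem_relCochain generator_mem
  refine rank_subquotient (n := 1) (k := 2) hle ?_ ?_
  · rw [relCocycle_four]
    exact rank_relCochain_four
  · rw [hB, Nat.cast_one]
    exact rank_span_singleton d_generator_ne_zero

end Weight

end GKF

open GKF in
theorem mainTheorem2 :
    (Module.rank ℝ (relCochain 0 4) = 0 ∧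
      Module.rank ℝ (relCochain 1 4) = 0 ∧
      Module.rank ℝ (relCochain 2 4) = 0 ∧
      Module.rank ℝ (relCochain 3 4) = 1 ∧
      Module.rank ℝ (relCochain 4 4) = 3 ∧
      ∀ m, 5 ≤ m → Module.rank ℝ (relCochain m 4) = 0) ∧
    (Module.rank ℝ (RelCohomology 0 4) = 0 ∧
      Module.rank ℝ (RelCohomology 1 4) = 0 ∧
      Module.rank ℝ (RelCohomology 2 4) = 0 ∧
      Module.rank ℝ (RelCohomology 3 4) = 0 ∧
      Module.rank ℝ (RelCohomology 4 4) = 2 ∧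
      ∀ m, 5 ≤ m → Module.rank ℝ (RelCohomology m 4) = 0) ∧
    ∃ A : Cochain Ham0 3,
      relCochain 3 4 = Submodule.span ℝ {A} ∧
      d A ≠ 0 ∧
      A ![basisElt 1 0 0 2, basisElt 2 1 0 0, basisElt 1 0 1 2] = -4 ∧
      A ![basisElt 0 0 1 2, basisElt 1 0 0 2, basisElt 3 1 0 0] = 2 ∧
      A ![basisElt 1 0 0 2, basisElt 2 0 1 0, basisElt 1 1 0 2] = 4 ∧
      A ![basisElt 0 0 1 2, basisElt 0 2 1 0, basisElt 2 1 1 0] = -2 ∧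
      A ![basisElt 0 0 1 2, basisElt 0 3 0 0, basisElt 2 0 2 0] = 1 ∧
      A ![basisElt 1 0 0 2, basisElt 3 0 0 0, basisElt 1 0 0 3] = -2 ∧
      A ![basisElt 0 0 1 2, basisElt 2 0 1 0, basisElt 1 2 0 1] = -4 ∧
      A ![basisElt 0 0 1 2, basisElt 2 1 0 0, basisElt 1 1 1 1] = 4 ∧
      A ![basisElt 0 0 0 3, basisElt 2 0 1 0, basisElt 2 1 0 1] = -2 ∧
      A ![basisElt 0 0 0 3, basisElt 2 1 0 0, basisElt 2 0 1 1] = 2 ∧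
      A ![basisElt 0 0 0 3, basisElt 3 0 0 0, basisElt 2 0 0 2] = 1 ∧
      A ![basisElt 0 0 1 2, basisElt 0 1 0 2, basisElt 4 0 0 0] = 1 ∧
      A ![basisElt 0 0 1 2, basisElt 0 1 1 1, basisElt 3 1 0 0] = 2 ∧
      A ![basisElt 0 0 1 2, basisElt 0 1 2 0, basisElt 2 2 0 0] = 1 := by
  have h0 : ∀ {m : ℕ}, relCochain m 4 = ⊥ → Module.rank ℝ (relCochain m 4) = 0 := fun h => by
    rw [h]; exact rank_bot ℝ _
  have hc : ∀ {m : ℕ}, relCochain m 4 = ⊥ → Module.rank ℝ (RelCohomology m 4) = 0 := fun h =>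
    rank_relCohomology_eq_zero (relCocycle_eq_bot h)
  have h5 : ∀ m, 5 ≤ m → relCochain m 4 = ⊥ := fun m hm => relCochain_eq_bot (by exact_mod_cast hm)
  have hA : generator ≠ 0 := fun h => d_generator_ne_zero (by rw [h, map_zero])
  refine ⟨⟨h0 relCochain_zero, h0 relCochain_one, h0 relCochain_two, ?_, rank_relCochain_four,
      fun m hm => h0 (h5 m hm)⟩,
    ⟨hc relCochain_zero, hc relCochain_one, hc relCochain_two,
      rank_relCohomology_eq_zero relCocycle_three, rank_relCohomology_four,
      fun m hm => hc (h5 m hm)⟩,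
    generator, relCochain_three, d_generator_ne_zero, ?_⟩
  · rw [relCochain_three]
    exact rank_span_singleton hA
  simp only [basisElt_eq_mono]
  refine ⟨?_, ?_, ?_, ?_, ?_, ?_, ?_, ?_, ?_, ?_, ?_, ?_, ?_, ?_⟩
  · exact_mod_cast generator_apply 1 0 0 2 2 1 0 0 1 0 1 2 (-4) (by decide +kernel)
  · exact_mod_cast generator_apply 0 0 1 2 1 0 0 2 3 1 0 0 (2) (by decide +kernel)
  · exact_mod_cast generator_apply 1 0 0 2 2 0 1 0 1 1 0 2 (4) (by decide +kernel)
  · exact_mod_cast generator_apply 0 0 1 2 0 2 1 0 2 1 1 0 (-2) (by decide +kernel)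
  · exact_mod_cast generator_apply 0 0 1 2 0 3 0 0 2 0 2 0 (1) (by decide +kernel)
  · exact_mod_cast generator_apply 1 0 0 2 3 0 0 0 1 0 0 3 (-2) (by decide +kernel)
  · exact_mod_cast generator_apply 0 0 1 2 2 0 1 0 1 2 0 1 (-4) (by decide +kernel)
  · exact_mod_cast generator_apply 0 0 1 2 2 1 0 0 1 1 1 1 (4) (by decide +kernel)
  · exact_mod_cast generator_apply 0 0 0 3 2 0 1 0 2 1 0 1 (-2) (by decide +kernel)
  · exact_mod_cast generator_apply 0 0 0 3 2 1 0 0 2 0 1 1 (2) (by decide +kernel)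
  · exact_mod_cast generator_apply 0 0 0 3 3 0 0 0 2 0 0 2 (1) (by decide +kernel)
  · exact_mod_cast generator_apply 0 0 1 2 0 1 0 2 4 0 0 0 (1) (by decide +kernel)
  · exact_mod_cast generator_apply 0 0 1 2 0 1 1 1 3 1 0 0 (2) (by decide +kernel)
  · exact_mod_cast generator_apply 0 0 1 2 0 1 2 0 2 2 0 0 (1) (by decide +kernel)
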